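/- **Setting.** Let $(M,\mathcal T)$ be a connected closed triangulated surface: the quotient of a finite disjoint union of triangles by identifying their edges in pairs by homeomorphisms; $V,E,F$ are its vertices, edges and faces. Let $\varepsilon:V\to\{0,1\}$ and $\eta:E\to\mathbb R$ satisfy $$\varepsilon_s\varepsilon_t+\eta_{st}>0\ \ \text{for all } \{st\}\in E,\qquad \varepsilon_q\eta_{st}+\eta_{qs}\eta_{qt}\ge 0\ \ \text{whenever } \{q,s,t\}=\{i,j,k\},\ \{ijk\}\in F .$$ For $u\in\mathbb R^V$ put $l_{ij}=\sqrt{\varepsilon_ie^{2u_i}+\varepsilon_je^{2u_j}+2\eta_{ij}e^{u_i+u_j}}$, and let $\Omega\subset\mathbb R^V$ be the set of those $u$ (the nondegenerate discrete conformal factors) for which the lengths $l_{ij},l_{ik},l_{jk}$ are positive and satisfy the strict triangle inequalities in every face $\{ijk\}$. In a face whose lengths satisfy the strict triangle inequalities let $\theta_i^{jk}$ be the inner angle at $i$ of the Euclidean triangle with these edge lengths, and put $\tilde\theta_i^{jk}=\theta_i^{jk}$; in a degenerate face put $\tilde\theta_i^{jk}=\pi$ if $l_{jk}\ge l_{ij}+l_{ik}$,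 and $\tilde\theta_i^{jk}=0$ otherwise. Let $K_i=2\pi-\sum\theta_i^{jk}$ for $u\in\Omega$ and $\tilde K_i=2\pi-\sum\tilde\theta_i^{jk}$ for $u\in\mathbb R^V$, the sums being over all corners of faces at the vertex $i$. For $\overline K\in\mathbb R^V$, the extended modified Euclidean combinatorial Ricci flow is $$\frac{du_i}{dt}=\overline K_i-\tilde K_i(u),\qquad i\in V.\tag{1}$$ **Theorem 2.12.** For every $\overline K\in\mathbb R^V$ the solution of (1) exists for all time for any initial value: for every $u_0\in\mathbb R^V$ there is a solution $u:[0,\infty)\to\mathbb R^V$ of (1) with $u(0)=u_0$, and every solution of (1) on a finite interval $[0,t_1)$, $t_1>0$, extends to a solution on $[0,\infty)$. Furthermore, if $\overline u\in\Omega$ is a nondegenerate factor with curvature $K(\overline u)=\overline K$, then every solution $u:[0,\infty)\to\mathbb R^V$ of (1) with $\sum_{i\in V}u_i(0)=\sum_{i\in V}\overline u_i$ converges exponentially fast to $\overline u$: there are constants $C,\lambda>0$ with $\|u(t)-\overline u\|\le Ce^{-\lambda t}$ for all $t\ge0$. -/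

import Mathlib

open Set

noncomputable section

namespace CombinatorialRicci

/-- A side of one of the triangles in `F`, traversed from the corner `tail` to the corner `head`;
the corners of each triangle are labelled by `Fin 3`. -/
@[ext]
structure DirectedSide (F : Type*) where
  face : F
  tail : Fin 3
  head : Fin 3
  ne : tail ≠ head

/-- The same side, traversed backwards. -/
def DirectedSide.reverse {F : Type*} (d : DirectedSide F) : DirectedSide F :=
  ⟨d.face, d.head, d.tail, d.ne.symm⟩

/-- A triangulated closed surface: a disjoint union of triangles (indexed by `F`) whose sides are
identified in pairs by homeomorphisms. Up to isotopy, such a homeomorphism between two sides is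
given by its effect on the directions of these sides: the side `d`, traversed from `tail` to
`head`, is identified with the side `glue d`, traversed from `tail` to `head`. Two distinct sides
of the same triangle may be identified, as may two corners of the same triangle. -/
structure Triangulation (F : Type*) where
  glue : DirectedSide F → DirectedSide F
  glue_glue : ∀ d, glue (glue d) = d
  glue_reverse : ∀ d, glue d.reverse = (glue d).reverse
  /-- No side is identified with itself, in either direction. -/
  glue_ne : ∀ d, glue d ≠ d
  glue_ne_reverse : ∀ d, glue d ≠ d.reverse

namespace Triangulation

variable {F : Type*} (T : Triangulation F)

/-- Corners are identified when they are initial points of identified directed sides. (As reversed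
sides are identified too, terminal points are covered as well.) -/
def CornerRel (c c' : F × Fin 3) : Prop :=
  ∃ d : DirectedSide F, c = (d.face, d.tail) ∧ c' = ((T.glue d).face, (T.glue d).tail)

/-- The set `V` of vertices: corners of triangles up to the identifications
(`Quot` passes to the generated equivalence relation). -/
def Vertex : Type _ := Quot T.CornerRel

/-- The vertex at the corner `a` of the triangle `f`. -/
def vertex (f : F) (a : Fin 3) : T.Vertex := Quot.mk _ (f, a)

instance [Finite F] : Finite T.Vertex :=
  inferInstanceAs (Finite (Quot T.CornerRel))

instance [Finite F] : Fintype T.Vertex := Fintype.ofFinite _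

/-- Directed sides are the same unoriented edge when they are reverse to each other or identified. -/
def SideRel (d d' : DirectedSide F) : Prop := d' = d.reverse ∨ d' = T.glue d

/-- The set `E` of unoriented edges. -/
def Edge : Type _ := Quot T.SideRel

/-- The edge of the triangulation given by a side of a triangle. -/
def edge (d : DirectedSide F) : T.Edge := Quot.mk _ d

/-- The side of the triangle `f` opposite to its corner `a`. -/
def oppSide (f : F) (a : Fin 3) : DirectedSide F :=
  ⟨f, a + 1, a + 2, by revert a; decide⟩

/-- The edge opposite to the corner `a` of the triangle `f`. -/
def oppEdge (f : F) (a : Fin 3) : T.Edge := T.edge (oppSide f a)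

/-- The surface is connected (and nonempty): any two triangles are joined by a chain of triangles
in which consecutive ones share an edge. -/
def Connected : Prop :=
  Nonempty F ∧
    ∀ f f' : F, Relation.ReflTransGen (fun g g' => ∃ d, d.face = g ∧ (T.glue d).face = g') f f'

/-- The weights `ε : V → {0, 1}` and `η : E → ℝ` satisfy the structure conditions:
`ε_s ε_t + η_st > 0` for every edge `st`, and `ε_q η_st + η_qs η_qt ≥ 0` whenever `q`, `s`, `t`
are the three corners of a triangle. -/
structure StructureConditions (ε : T.Vertex → ℝ) (η : T.Edge → ℝ) : Prop where
  zero_or_one : ∀ v, ε v = 0 ∨ ε v = 1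
  edge_pos : ∀ d : DirectedSide F,
    0 < ε (T.vertex d.face d.tail) * ε (T.vertex d.face d.head) + η (T.edge d)
  face_nonneg : ∀ (f : F) (a : Fin 3),
    0 ≤ ε (T.vertex f a) * η (T.oppEdge f a) + η (T.oppEdge f (a + 1)) * η (T.oppEdge f (a + 2))

variable (ε : T.Vertex → ℝ) (η : T.Edge → ℝ)

/-- The Euclidean length `√(ε_i e^{2u_i} + ε_j e^{2u_j} + 2 η_ij e^{u_i + u_j})` of the edge `ij`
given by a side of a triangle. -/
def length (u : T.Vertex → ℝ) (d : DirectedSide F) : ℝ :=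
  let i := T.vertex d.face d.tail
  let j := T.vertex d.face d.head
  √(ε i * Real.exp (2 * u i) + ε j * Real.exp (2 * u j)
    + 2 * η (T.edge d) * Real.exp (u i + u j))

/-- The length of the edge opposite to the corner `a` of the triangle `f`. -/
def oppLength (u : T.Vertex → ℝ) (f : F) (a : Fin 3) : ℝ :=
  T.length ε η u (oppSide f a)

/-- The edge lengths of the triangle `f` are those of a nondegenerate Euclidean triangle: they are
positive and satisfy the strict triangle inequalities. -/
def NondegenerateFace (u : T.Vertex → ℝ) (f : F) : Prop :=
  ∀ a : Fin 3, 0 < T.oppLength ε η u f a ∧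
    T.oppLength ε η u f a < T.oppLength ε η u f (a + 1) + T.oppLength ε η u f (a + 2)

/-- The admissible space `Ω` of nondegenerate Euclidean discrete conformal factors. -/
def admissible : Set (T.Vertex → ℝ) := {u | ∀ f, T.NondegenerateFace ε η u f}

/-- The inner angle at the corner `a` of a nondegenerate Euclidean triangle `f` with the given edge
lengths (law of cosines). -/
def angle (u : T.Vertex → ℝ) (f : F) (a : Fin 3) : ℝ :=
  Real.arccos ((T.oppLength ε η u f (a + 1) ^ 2 + T.oppLength ε η u f (a + 2) ^ 2
    - T.oppLength ε η u f a ^ 2)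
      / (2 * T.oppLength ε η u f (a + 1) * T.oppLength ε η u f (a + 2)))

open Classical in
/-- The extension of the inner angles by constants. For positive lengths, the factors at which the
triangle degenerates form three disjoint closed regions, according to which of the edges is at
least as long as the other two together; the angle is set to `π` on the region of the edge opposite
to the corner (on whose boundary the inner angle tends to `π`) and to `0` on the other two. -/
def extAngle (u : T.Vertex → ℝ) (f : F) (a : Fin 3) : ℝ :=
  if T.NondegenerateFace ε η u f then T.angle ε η u f a
  else if T.oppLength ε η u f (a + 1) + T.oppLength ε η u f (a + 2) ≤ T.oppLength ε η u f a
    then Real.pi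
  else 0

variable [Fintype F]

open Classical in
/-- The combinatorial curvature `K`: `2π` less the sum of the inner angles at the vertex `v`. -/
def curvature (u : T.Vertex → ℝ) (v : T.Vertex) : ℝ :=
  2 * Real.pi - ∑ f : F, ∑ a : Fin 3, if T.vertex f a = v then T.angle ε η u f a else 0

open Classical in
/-- The generalized combinatorial curvature: `2π` less the sum of the extended inner angles. -/
def extCurvature (u : T.Vertex → ℝ) (v : T.Vertex) : ℝ :=
  2 * Real.pi - ∑ f : F, ∑ a : Fin 3, if T.vertex f a = v then T.extAngle ε η u f a else 0

/-- `u` solves the extended modified Euclidean combinatorial Ricci flow with prescribed curvature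
`Kbar` on the time interval `I`. (Derivatives at end points that belong to `I` are one-sided.) -/
def IsFlowOn (Kbar : T.Vertex → ℝ) (u : ℝ → T.Vertex → ℝ) (I : Set ℝ) : Prop :=
  ∀ t ∈ I, ∀ v,
    HasDerivWithinAt (fun s => u s v) (Kbar v - T.extCurvature ε η (u t) v) I t

end Triangulation

end CombinatorialRicci

end

/-! Write (1) as u' = f(u) on Euclidean space. Everything rests on f being bounded, continuous and
dissipative: ⟪f x - f y, x - y⟫ ≤ 0. Such a field has a forward solution from every point
(`exists_global_solution`), and two solutions never move apart, which gives uniqueness and hence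
extension (`eqOn_of_dissipative`). No Lipschitz bound is needed; `arccos` would not supply one at
±1.

Pairing f with a vector regroups the angles by faces (`inner_flowField`), so dissipativity is a
statement about one triangle. While the triangle is nondegenerate, the angle differential is a
quadratic form in the differences of the factors. Its definiteness reduces to Heron's formula and to
the sign of the Jacobian of the squared lengths, which the structure conditions make positive
(`form_nonneg`, `minor_pos`). In a degenerate triangle the angles only take the values 0 and π, so
along a line a continuous combination of them cannot increase across degenerate stretches
(`antitone_of_finite_image_compl`).

For convergence, f vanishes at the prescribed factor, and by connectedness its differential there is
negative definite on vectors of sum zero. The resulting estimate near the zero spreads to arbitrary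
balls by dissipativity (`inner_le_of_local`). The sum of the factors is conserved by Gauss–Bonnet,
and a Gronwall argument gives the exponential rate. -/

noncomputable section

namespace DissipativeFlow

open Filter Topology MeasureTheory
open scoped RealInnerProductSpace

/-! ### Forward solutions of bounded continuous dissipative vector fields -/

section Existence

variable {E : Type*} [NormedAddCommGroup E] [InnerProductSpace ℝ E]

/-- The iterates of the integral operator with delay `h`. -/
def delayIterate (f : E → E) (x₀ : E) (h : ℝ) : ℕ → ℝ → E
  | 0, _ => x₀
  | k + 1, t => x₀ + ∫ s in (0 : ℝ)..t, f (delayIterate f x₀ h k (max (s - h) 0))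

variable {f : E → E} {x₀ : E} {h : ℝ}

theorem continuous_delayIterate (hf : Continuous f) (k : ℕ) :
    Continuous (delayIterate f x₀ h k) := by
  induction k with
  | zero => exact continuous_const
  | succ k ih =>
    have hc : Continuous fun s => f (delayIterate f x₀ h k (max (s - h) 0)) := by fun_prop
    exact continuous_const.add
      (intervalIntegral.continuous_primitive (fun a b => hc.intervalIntegrable a b) 0)

theorem hasDerivAt_delayIterate [CompleteSpace E] (hf : Continuous f) (k : ℕ) (t : ℝ) :
    HasDerivAt (delayIterate f x₀ h (k + 1)) (f (delayIterate f x₀ h k (max (t - h) 0))) t := by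
  have hc : Continuous fun s => f (delayIterate f x₀ h k (max (s - h) 0)) := by
    have := continuous_delayIterate (x₀ := x₀) (h := h) hf k
    fun_prop
  exact (hc.integral_hasStrictDerivAt 0 t).hasDerivAt.const_add x₀

/-- Up to time (k + 1)h the integrand only looks at times up to kh, so each stage settles one more
step of length h. A settled iterate solves the delay equation w'(t) = f (w (t - h)). -/
theorem delayIterate_succ_eq (hh : 0 ≤ h) (k : ℕ) :
    ∀ t ∈ Icc 0 (k * h), delayIterate f x₀ h (k + 1) t = delayIterate f x₀ h k t := by
  induction k with
  | zero =>
    intro t ht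
    have : t = 0 := by simpa using ht
    simp [delayIterate, this]
  | succ k ih =>
    intro t ht
    rw [delayIterate, delayIterate]
    congr 1
    refine intervalIntegral.integral_congr fun s hs => ?_
    rw [uIcc_of_le ht.1] at hs
    have := ht.2
    push_cast at this
    rw [ih _ ⟨le_max_right _ _, max_le (by linarith [hs.2]) (by positivity)⟩]

theorem norm_delayIterate_sub_le [CompleteSpace E] (hf : Continuous f) {M : ℝ} (hM : ∀ x, ‖f x‖ ≤ M) (k : ℕ)
    (s t : ℝ) :
    ‖delayIterate f x₀ h (k + 1) t - delayIterate f x₀ h (k + 1) s‖ ≤ M * |t - s| := by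
  simpa using Convex.norm_image_sub_le_of_norm_hasDerivWithin_le (s := univ)
    (fun x _ => (hasDerivAt_delayIterate (x₀ := x₀) (h := h) hf k x).hasDerivWithinAt)
    (fun x _ => hM _) convex_univ (mem_univ s) (mem_univ t)

/-- Approximate solutions with small defects: `w' = f ∘ z` with `z` close to `w`. -/
theorem exists_approximate_solution [CompleteSpace E] (hf : Continuous f) {M : ℝ} (hM : ∀ x, ‖f x‖ ≤ M) (x₀ : E)
    (n : ℕ) :
    ∃ w z : ℝ → E, w 0 = x₀ ∧ Continuous z ∧ (∀ t, HasDerivAt w (f (z t)) t) ∧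
      ∀ t ∈ Icc (0 : ℝ) n, ‖z t - w t‖ ≤ M * (1 / (n + 1)) := by
  set h : ℝ := 1 / (n + 1) with hh
  have hpos : 0 < h := by positivity
  have hM0 : 0 ≤ M := (norm_nonneg _).trans (hM 0)
  -- Since k * h = n, the stages k + 1 and k + 2 agree on [0, n]; there `z` is `w` looked up at most
  -- h earlier, and `w` has Lipschitz constant M.
  set k := n * (n + 1)
  have hk : (k : ℝ) * h = n := by simp only [k, hh]; push_cast; field_simp
  refine ⟨delayIterate f x₀ h (k + 1 + 1), fun t => delayIterate f x₀ h (k + 1) (max (t - h) 0), ?_,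
    ?_, fun t => hasDerivAt_delayIterate hf _ t, fun t ht => ?_⟩
  · simp [delayIterate]
  · have := continuous_delayIterate (x₀ := x₀) (h := h) hf (k + 1)
    fun_prop
  · have htk : t ∈ Icc (0 : ℝ) ((k + 1 : ℕ) * h) := by
      refine ⟨ht.1, ?_⟩
      push_cast
      nlinarith [ht.2]
    rw [delayIterate_succ_eq hpos.le (k + 1) t htk]
    refine (norm_delayIterate_sub_le hf hM k _ _).trans ?_
    gcongr
    rw [abs_le]
    constructor
    · linarith [le_max_left (t - h) 0]
    · linarith [max_le (by linarith : t - h ≤ t + h) (by linarith [ht.1] : (0 : ℝ) ≤ t + h)]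

/-- Dissipativity controls the pairing with z - z'. Replacing w - w' by z - z' costs at most 2M(δ +
δ') in the inner product, and the derivative of the squared norm doubles this. -/
theorem norm_sub_sq_le_of_approximate_solution
    {M : ℝ} (hM : ∀ x, ‖f x‖ ≤ M)
    (hdiss : ∀ x y, ⟪f x - f y, x - y⟫ ≤ 0) {w z w' z' : ℝ → E} {δ δ' T : ℝ}
    (h0 : w 0 = w' 0)
    (hw : ∀ t, HasDerivAt w (f (z t)) t) (hw' : ∀ t, HasDerivAt w' (f (z' t)) t)
    (hδ : ∀ t ∈ Icc 0 T, ‖z t - w t‖ ≤ δ) (hδ' : ∀ t ∈ Icc 0 T, ‖z' t - w' t‖ ≤ δ') :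
    ∀ t ∈ Icc 0 T, ‖w t - w' t‖ ^ 2 ≤ 4 * M * (δ + δ') * t := by
  intro t ht
  have hd : ∀ t, HasDerivAt (fun t => ‖w t - w' t‖ ^ 2 - 4 * M * (δ + δ') * t)
      (2 * ⟪w t - w' t, f (z t) - f (z' t)⟫ - 4 * M * (δ + δ')) t := fun t => by
    have := ((hw t).sub (hw' t)).norm_sq.sub ((hasDerivAt_id t).const_mul (4 * M * (δ + δ')))
    rw [mul_one] at this
    exact this
  have hanti : AntitoneOn (fun t => ‖w t - w' t‖ ^ 2 - 4 * M * (δ + δ') * t) (Icc 0 T) := by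
    refine antitoneOn_of_deriv_nonpos (convex_Icc 0 T)
      (fun t _ => (hd t).continuousAt.continuousWithinAt)
      (fun t _ => (hd t).differentiableAt.differentiableWithinAt) fun t ht => ?_
    have ht' := interior_subset ht
    rw [(hd t).deriv]
    have h1 : ⟪w t - w' t, f (z t) - f (z' t)⟫
        = ⟪f (z t) - f (z' t), z t - z' t⟫
          + ⟪f (z t) - f (z' t), (w t - z t) + (z' t - w' t)⟫ := by
      rw [real_inner_comm, ← inner_add_right]
      congr 1
      abel
    have h2 : ⟪f (z t) - f (z' t), (w t - z t) + (z' t - w' t)⟫ ≤ (2 * M) * (δ + δ') := by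
      refine (real_inner_le_norm _ _).trans ?_
      gcongr
      · linarith [(norm_nonneg _).trans (hM 0)]
      · linarith [norm_sub_le (f (z t)) (f (z' t)), hM (z t), hM (z' t)]
      · refine (norm_add_le _ _).trans (add_le_add ?_ (hδ' t ht'))
        rw [norm_sub_rev]
        exact hδ t ht'
    linarith [hdiss (z t) (z' t)]
  have := hanti (left_mem_Icc.2 (ht.1.trans ht.2)) ht ht.1
  simp only [h0] at this
  simp at this
  linarith

/-- A bounded continuous dissipative vector field has a forward integral curve through each
point. -/
theorem exists_global_solution [CompleteSpace E] (hf : Continuous f) {M : ℝ} (hM : ∀ x, ‖f x‖ ≤ M)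
    (hdiss : ∀ x y, ⟪f x - f y, x - y⟫ ≤ 0) (x₀ : E) :
    ∃ u : ℝ → E, u 0 = x₀ ∧ ∀ t ∈ Ici (0 : ℝ), HasDerivWithinAt u (f (u t)) (Ici 0) t := by
  have hM0 : 0 ≤ M := (norm_nonneg _).trans (hM 0)
  choose w z hw0 hzc hw hz using exists_approximate_solution hf hM x₀
  have hcauchy : ∀ t, 0 ≤ t → CauchySeq fun n => w n t := by
    intro t ht
    refine Metric.cauchySeq_iff'.2 fun ε hε => ?_
    -- N ≥ t keeps t in the range of validity of the defect bounds; the other bound makes 8M²t / (N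
    -- + 1) smaller than ε².
    obtain ⟨N, hN⟩ := exists_nat_gt (max t (8 * M * M * t / ε ^ 2))
    refine ⟨N, fun n hn => ?_⟩
    have hn' : (N : ℝ) ≤ n := by exact_mod_cast hn
    have htN : t ≤ N := (le_max_left _ _).trans hN.le
    have hN' : 8 * M * M * t < N * ε ^ 2 := by
      rw [← div_lt_iff₀ (by positivity)]
      exact (le_max_right _ _).trans_lt hN
    have key := norm_sub_sq_le_of_approximate_solution hM hdiss ((hw0 n).trans (hw0 N).symm) (hw n)
      (hw N) (T := N) (fun s hs => hz n s ⟨hs.1, hs.2.trans hn'⟩) (hz N) t ⟨ht, htN⟩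
    have h1 : (1 : ℝ) / (n + 1) ≤ 1 / (N + 1) := by gcongr
    have h2 : 4 * M * (M * (1 / (n + 1)) + M * (1 / (N + 1))) * t ≤ 8 * M * M * t * (1 / (N + 1)) := by
      have : 4 * M * (M * (1 / (n + 1)) + M * (1 / (N + 1))) * t
          ≤ 4 * M * (M * (1 / (N + 1)) + M * (1 / (N + 1))) * t := by gcongr
      linarith
    have h3 : 8 * M * M * t * (1 / (N + 1)) < ε ^ 2 := by
      rw [mul_one_div, div_lt_iff₀ (by positivity)]
      nlinarith [sq_nonneg ε]
    rw [dist_eq_norm]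
    exact lt_of_pow_lt_pow_left₀ 2 hε.le (key.trans_lt (h2.trans_lt h3))
  choose! u hu using fun t ht => cauchySeq_tendsto_of_complete (hcauchy t ht)
  have hulip : ∀ s t, 0 ≤ s → 0 ≤ t → ‖u t - u s‖ ≤ M * |t - s| := by
    intro s t hs ht
    refine le_of_tendsto ((hu t ht).sub (hu s hs)).norm (Eventually.of_forall fun n => ?_)
    simpa using Convex.norm_image_sub_le_of_norm_hasDerivWithin_le (s := univ)
      (fun x _ => (hw n x).hasDerivWithinAt) (fun x _ => hM _) convex_univ (mem_univ s) (mem_univ t)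
  have hzu : ∀ t, 0 ≤ t → Tendsto (fun n => z n t) atTop (𝓝 (u t)) := by
    intro t ht
    have h1 : Tendsto (fun n => z n t - w n t) atTop (𝓝 0) := by
      have h2 : Tendsto (fun n : ℕ => M * (1 / ((n : ℝ) + 1))) atTop (𝓝 0) := by
        simpa using tendsto_one_div_add_atTop_nhds_zero_nat.const_mul M
      refine squeeze_zero_norm' ?_ h2
      obtain ⟨N, hN⟩ := exists_nat_ge t
      filter_upwards [eventually_ge_atTop N] with n hn
      exact hz n t ⟨ht, hN.trans (by exact_mod_cast hn)⟩
    simpa using h1.add (hu t ht)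
  -- Nothing is known about `u` at negative times; freezing it there gives a function continuous on
  -- all of ℝ.
  set v : ℝ → E := fun t => u (max t 0)
  have hvc : Continuous v := by
    have : LipschitzWith M.toNNReal v := LipschitzWith.of_dist_le_mul fun s t => by
      rw [dist_eq_norm, Real.coe_toNNReal _ hM0, Real.dist_eq]
      refine (hulip _ _ (le_max_right _ _) (le_max_right _ _)).trans ?_
      exact mul_le_mul_of_nonneg_left (abs_max_sub_max_le_abs s t 0) hM0
    exact this.continuous
  have hfv : Continuous fun s => f (v s) := hf.comp hvc
  have hint : ∀ t, 0 ≤ t → u t = x₀ + ∫ s in (0 : ℝ)..t, f (v s) := by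
    intro t ht
    have h1 : Tendsto (fun n => x₀ + ∫ s in (0 : ℝ)..t, f (z n s)) atTop
        (𝓝 (x₀ + ∫ s in (0 : ℝ)..t, f (v s))) := by
      refine tendsto_const_nhds.add
        (intervalIntegral.tendsto_integral_filter_of_dominated_convergence (fun _ => M)
          (Eventually.of_forall fun n => (hf.comp (hzc n)).aestronglyMeasurable)
          (Eventually.of_forall fun n => Eventually.of_forall fun s _ => hM _)
          intervalIntegrable_const (Eventually.of_forall fun s hs => ?_))
      rw [uIoc_of_le ht] at hs
      have : v s = u s := by simp [v, hs.1.le]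
      rw [this]
      exact (hf.tendsto _).comp (hzu s hs.1.le)
    refine tendsto_nhds_unique (hu t ht) (h1.congr fun n => ?_)
    rw [intervalIntegral.integral_eq_sub_of_hasDerivAt (fun s _ => hw n s)
      ((hf.comp (hzc n)).intervalIntegrable _ _), hw0 n]
    abel
  refine ⟨u, by simpa using hint 0 le_rfl, fun t ht => ?_⟩
  have h1 := ((hfv.integral_hasStrictDerivAt 0 t).hasDerivAt.const_add x₀).hasDerivWithinAt
    (s := Ici 0)
  have : v t = u t := by simp only [v, max_eq_left (show (0 : ℝ) ≤ t from ht)]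
  rw [this] at h1
  exact h1.congr (fun s hs => hint s hs) (hint t ht)

end Existence

/-! ### Uniqueness and exponential convergence for dissipative fields -/

section Asymptotics

variable {E : Type*} [NormedAddCommGroup E] [InnerProductSpace ℝ E] {f : E → E}

/-- The distance between two integral curves of a dissipative vector field does not increase. -/
theorem antitoneOn_norm_sub_sq (hdiss : ∀ x y, ⟪f x - f y, x - y⟫ ≤ 0) {I : Set ℝ}
    (hI : Convex ℝ I) {u w : ℝ → E}
    (hu : ∀ t ∈ I, HasDerivWithinAt u (f (u t)) I t)
    (hw : ∀ t ∈ I, HasDerivWithinAt w (f (w t)) I t) :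
    AntitoneOn (fun t => ‖u t - w t‖ ^ 2) I := by
  have hd := fun t ht => ((hu t ht).sub (hw t ht)).norm_sq
  refine antitoneOn_of_deriv_nonpos hI (fun t ht => (hd t ht).continuousWithinAt)
    (fun t ht => ((hd t (interior_subset ht)).mono interior_subset).differentiableWithinAt)
    fun t ht => ?_
  have h1 := ((hd t (interior_subset ht)).hasDerivAt (mem_interior_iff_mem_nhds.1 ht)).deriv
  have h2 := hdiss (u t) (w t)
  rw [real_inner_comm] at h2
  exact h1.trans_le (mul_nonpos_of_nonneg_of_nonpos zero_le_two h2)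

theorem eqOn_of_dissipative (hdiss : ∀ x y, ⟪f x - f y, x - y⟫ ≤ 0) {T : ℝ} (hT : 0 < T)
    {u w : ℝ → E}
    (hu : ∀ t ∈ Ico 0 T, HasDerivWithinAt u (f (u t)) (Ico 0 T) t)
    (hw : ∀ t ∈ Ico 0 T, HasDerivWithinAt w (f (w t)) (Ico 0 T) t) (h0 : u 0 = w 0) :
    EqOn u w (Ico 0 T) := by
  intro t ht
  have h1 := antitoneOn_norm_sub_sq hdiss (convex_Ico 0 T) hu hw (left_mem_Ico.2 hT) ht ht.1
  simp only [h0, sub_self, norm_zero] at h1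
  have h2 : ‖u t - w t‖ = 0 := by nlinarith [norm_nonneg (u t - w t)]
  exact sub_eq_zero.1 (norm_eq_zero.1 h2)

/-- An estimate near a zero of a dissipative vector field extends to larger balls. -/
theorem inner_le_of_local (hdiss : ∀ x y, ⟪f x - f y, x - y⟫ ≤ 0) {x : E} {W : Submodule ℝ E}
    {r c R : ℝ} (hr : 0 < r) (hc : 0 < c) (hR : r ≤ R)
    (hloc : ∀ v ∈ W, ‖v‖ ≤ r → ⟪f (x + v), v⟫ ≤ -(c * ‖v‖ ^ 2)) :
    ∀ v ∈ W, ‖v‖ ≤ R → ⟪f (x + v), v⟫ ≤ -(c * r / R * ‖v‖ ^ 2) := by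
  intro v hv hvR
  have hR0 : 0 < R := hr.trans_le hR
  rcases le_or_gt ‖v‖ r with hvr | hvr
  · refine (hloc v hv hvr).trans ?_
    gcongr
    rw [div_le_iff₀ hR0]
    gcongr
  · have hv0 : 0 < ‖v‖ := hr.trans hvr
    -- The point x + a • v lies on the segment at distance r from x. Dissipativity makes s ↦ ⟪f (x +
    -- s • v), v⟫ nonincreasing, so the bound there persists at s = 1, with decay only linear in
    -- ‖v‖; ‖v‖ ≤ R turns it into a quadratic one.
    set a := r / ‖v‖ with ha
    have ha0 : 0 < a := by positivity
    have ha1 : a < 1 := (div_lt_one hv0).2 hvr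
    have hav : a * ‖v‖ = r := by rw [ha]; field_simp
    have hn : ‖a • v‖ = r := by rw [norm_smul, Real.norm_of_nonneg ha0.le, hav]
    have h1 := hloc (a • v) (W.smul_mem a hv) hn.le
    have h2 := hdiss (x + v) (x + a • v)
    have h3 : x + v - (x + a • v) = (1 - a) • v := by rw [sub_smul, one_smul]; abel
    rw [h3, inner_smul_right, inner_sub_left] at h2
    have h4 : ⟪f (x + v), v⟫ ≤ ⟪f (x + a • v), v⟫ := by
      by_contra! h
      nlinarith
    rw [hn, inner_smul_right] at h1
    have h5 : ⟪f (x + a • v), v⟫ ≤ -(c * r * ‖v‖) := by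
      rw [← hav] at h1 ⊢
      by_contra! h
      nlinarith [mul_lt_mul_of_pos_left h ha0]
    have h6 : c * r / R * ‖v‖ ^ 2 ≤ c * r * ‖v‖ := by
      rw [div_mul_eq_mul_div, div_le_iff₀ hR0, pow_two, ← mul_assoc]
      gcongr
    linarith

/-- The zero x is itself an integral curve, so the distance to it never grows and u stays in a fixed
ball. There the enlarged estimate holds with some rate κ, and ‖u t - x‖² e^{2κt} is nonincreasing.
-/
theorem exponential_decay_of_local (hdiss : ∀ x y, ⟪f x - f y, x - y⟫ ≤ 0) {x : E} (hx : f x = 0)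
    {W : Submodule ℝ E} {r c : ℝ} (hr : 0 < r) (hc : 0 < c)
    (hloc : ∀ v ∈ W, ‖v‖ ≤ r → ⟪f (x + v), v⟫ ≤ -(c * ‖v‖ ^ 2)) {u : ℝ → E}
    (hu : ∀ t ∈ Ici (0 : ℝ), HasDerivWithinAt u (f (u t)) (Ici 0) t)
    (hW : ∀ t, 0 ≤ t → u t - x ∈ W) :
    ∃ C > 0, ∃ lam > 0, ∀ t ≥ 0, ‖u t - x‖ ≤ C * Real.exp (-(lam * t)) := by
  set R := ‖u 0 - x‖ + r
  have hR : 0 < R := by positivity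
  set κ := c * r / R
  have hκ : 0 < κ := by positivity
  have hconst : ∀ t ∈ Ici (0 : ℝ), HasDerivWithinAt (fun _ : ℝ => x) (f x) (Ici 0) t := by
    intro t _
    rw [hx]
    exact hasDerivWithinAt_const _ _ _
  have hanti := antitoneOn_norm_sub_sq hdiss (convex_Ici 0) hu hconst
  have hbound : ∀ t, 0 ≤ t → ‖u t - x‖ ≤ R := by
    intro t ht
    have h1 : ‖u t - x‖ ^ 2 ≤ ‖u 0 - x‖ ^ 2 := hanti self_mem_Ici (mem_Ici.2 ht) ht
    have h2 := le_of_sq_le_sq h1 (norm_nonneg _)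
    exact h2.trans (le_add_of_nonneg_right hr.le)
  have hbig := inner_le_of_local hdiss hr hc (le_add_of_nonneg_left (norm_nonneg (u 0 - x))) hloc
  have hd : ∀ t ∈ Ici (0 : ℝ), HasDerivWithinAt (fun t => ‖u t - x‖ ^ 2 * Real.exp (2 * κ * t))
      (2 * ⟪u t - x, f (u t)⟫ * Real.exp (2 * κ * t)
        + ‖u t - x‖ ^ 2 * (Real.exp (2 * κ * t) * (2 * κ))) (Ici 0) t := by
    intro t ht
    have h1 := ((hu t ht).sub_const x).norm_sq
    have h2 : HasDerivAt (fun t : ℝ => Real.exp (2 * κ * t))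
        (Real.exp (2 * κ * t) * (2 * κ)) t := by
      simpa using ((hasDerivAt_id t).const_mul (2 * κ)).exp
    exact h1.mul h2.hasDerivWithinAt
  have hanti' : AntitoneOn (fun t => ‖u t - x‖ ^ 2 * Real.exp (2 * κ * t)) (Ici 0) := by
    refine antitoneOn_of_deriv_nonpos (convex_Ici 0) (fun t ht => (hd t ht).continuousWithinAt)
      (fun t ht => ((hd t (interior_subset ht)).mono interior_subset).differentiableWithinAt)
      fun t ht => ?_
    rw [((hd t (interior_subset ht)).hasDerivAt (mem_interior_iff_mem_nhds.1 ht)).deriv]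
    have ht0 : (0 : ℝ) ≤ t := interior_subset ht
    have h1 := hbig _ (hW t ht0) (hbound t ht0)
    rw [add_sub_cancel, real_inner_comm] at h1
    nlinarith [Real.exp_pos (2 * κ * t)]
  refine ⟨‖u 0 - x‖ + 1, by positivity, κ, hκ, fun t ht => ?_⟩
  have h1 : ‖u t - x‖ ^ 2 * Real.exp (2 * κ * t) ≤ ‖u 0 - x‖ ^ 2 * Real.exp (2 * κ * 0) :=
    hanti' self_mem_Ici (mem_Ici.2 ht) ht
  rw [mul_zero, Real.exp_zero, mul_one] at h1
  have h2 : Real.exp (2 * κ * t) = Real.exp (κ * t) ^ 2 := by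
    rw [← Real.exp_nat_mul]
    ring_nf
  rw [h2, ← mul_pow] at h1
  have h3 := le_of_sq_le_sq h1 (norm_nonneg _)
  rw [Real.exp_neg, ← div_eq_mul_inv, le_div_iff₀ (Real.exp_pos _)]
  linarith

/-- Compactness of the unit sphere of W makes the negativity uniform, with constant 2c; half of it
absorbs the Taylor remainder close to x. -/
theorem exists_local_bound [FiniteDimensional ℝ E] {x : E} (hx : f x = 0) {f' : E →L[ℝ] E}
    (hf' : HasFDerivAt f f' x) {W : Submodule ℝ E} (hW : ∀ v ∈ W, v ≠ 0 → ⟪f' v, v⟫ < 0) :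
    ∃ r > 0, ∃ c > 0, ∀ v ∈ W, ‖v‖ ≤ r → ⟪f (x + v), v⟫ ≤ -(c * ‖v‖ ^ 2) := by
  obtain ⟨c, hc, hcW⟩ : ∃ c > 0, ∀ v ∈ W, ⟪f' v, v⟫ ≤ -(2 * c * ‖v‖ ^ 2) := by
    have hK : IsCompact (Metric.sphere (0 : E) 1 ∩ W) :=
      (isCompact_sphere 0 1).inter_right W.closed_of_finiteDimensional
    obtain ⟨m, hm, hmK⟩ : ∃ m > 0, ∀ v ∈ Metric.sphere (0 : E) 1 ∩ W, ⟪f' v, v⟫ ≤ -m := by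
      rcases (Metric.sphere (0 : E) 1 ∩ (W : Set E)).eq_empty_or_nonempty with h | h
      · exact ⟨1, one_pos, by simp [h]⟩
      · obtain ⟨v, hv, hmax⟩ := hK.exists_isMaxOn h
          (f := fun v => ⟪f' v, v⟫) (by fun_prop)
        have hv0 : v ≠ 0 := Metric.ne_of_mem_sphere hv.1 one_ne_zero
        exact ⟨-⟪f' v, v⟫, neg_pos.2 (hW v hv.2 hv0), fun w hw => by simpa using hmax hw⟩
    refine ⟨m / 2, by positivity, fun v hv => ?_⟩
    rcases eq_or_ne v 0 with rfl | hv0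
    · simp
    · have hn : 0 < ‖v‖ := norm_pos_iff.2 hv0
      have h1 := hmK (‖v‖⁻¹ • v)
        ⟨by simp [norm_smul, hn.ne'], W.smul_mem _ hv⟩
      rw [map_smul, inner_smul_left, inner_smul_right] at h1
      simp only [conj_trivial] at h1
      rw [← mul_assoc, ← mul_inv, inv_mul_le_iff₀ (by positivity)] at h1
      linarith
  have hlit := (hasFDerivAt_iff_isLittleO_nhds_zero.1 hf').def hc
  obtain ⟨r, hr, hball⟩ := Metric.eventually_nhds_iff_ball.1 hlit
  refine ⟨r / 2, by positivity, c, hc, fun v hv hvr => ?_⟩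
  have h1 := hball v (by rw [mem_ball_zero_iff]; linarith)
  rw [hx, sub_zero] at h1
  have h2 : ⟪f (x + v), v⟫ = ⟪f (x + v) - f' v, v⟫ + ⟪f' v, v⟫ := by
    rw [← inner_add_left, sub_add_cancel]
  have h3 := real_inner_le_norm (f (x + v) - f' v) v
  nlinarith [hcW v hv, norm_nonneg v]

end Asymptotics

end DissipativeFlow

/-! ### Law of cosines, and the differential of the angles of a triangle -/

namespace Triangle

/-- The law of cosines, differentiated in terms of the squared lengths. -/
theorem hasDerivAt_arccos_of_sq {a b c : ℝ → ℝ} {a' b' c' s : ℝ} (ha : HasDerivAt a a' s)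
    (hb : HasDerivAt b b' s) (hc : HasDerivAt c c' s) (hb0 : 0 < b s) (hc0 : 0 < c s)
    (hS : 0 < 4 * b s * c s - (b s + c s - a s) ^ 2) :
    HasDerivAt (fun s => Real.arccos ((b s + c s - a s) / (2 * √(b s) * √(c s))))
      ((a' - (a s + b s - c s) / (2 * b s) * b' - (a s + c s - b s) / (2 * c s) * c')
        / √(4 * b s * c s - (b s + c s - a s) ^ 2)) s := by
  have hβ := Real.sqrt_pos.2 hb0
  have hγ := Real.sqrt_pos.2 hc0
  have hβ2 := Real.sq_sqrt hb0.le
  have hγ2 := Real.sq_sqrt hc0.le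
  have hd := ((hb.add hc).sub ha).div (((hb.sqrt hb0.ne').const_mul 2).mul (hc.sqrt hc0.ne'))
    (mul_pos (mul_pos two_pos hβ) hγ).ne'
  set S := √(4 * b s * c s - (b s + c s - a s) ^ 2) with hSdef
  have hS0 : 0 < S := Real.sqrt_pos.2 hS
  have hS2 : S ^ 2 = 4 * b s * c s - (b s + c s - a s) ^ 2 := Real.sq_sqrt hS.le
  set β := √(b s)
  set γ := √(c s)
  -- By Heron, S is four times the area, so S / (2βγ) is the sine of the angle.
  have hcos : 1 - ((b s + c s - a s) / (2 * β * γ)) ^ 2 = (S / (2 * β * γ)) ^ 2 := by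
    rw [div_pow, div_pow, hS2, mul_pow, mul_pow, hβ2, hγ2]
    field_simp
    ring
  have hlt : ((b s + c s - a s) / (2 * β * γ)) ^ 2 < 1 := by
    have : 0 < (S / (2 * β * γ)) ^ 2 := by positivity
    linarith
  have hne1 : (b s + c s - a s) / (2 * β * γ) ≠ -1 := fun h => by rw [h] at hlt; norm_num at hlt
  have hne2 : (b s + c s - a s) / (2 * β * γ) ≠ 1 := fun h => by rw [h] at hlt; norm_num at hlt
  refine ((Real.hasDerivAt_arccos hne1 hne2).comp s hd).congr_deriv ?_
  rw [hcos, Real.sqrt_sq (by positivity)]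
  simp only [Pi.add_apply, Pi.sub_apply, Pi.mul_apply]
  change -(1 / (S / (2 * β * γ))) * (((b' + c' - a') * (2 * β * γ) - (b s + c s - a s) *
    (2 * (b' / (2 * β)) * γ + 2 * β * (c' / (2 * γ)))) / (2 * β * γ) ^ 2) = _
  rw [← hβ2, ← hγ2]
  field_simp
  ring

/-- For the cosines P, Q, R, the product of the first two sines is PQ + R, so the addition formula
gives cosine -R for the sum of the first two angles. That this sum is at most π follows from P + Q ≥
0. -/
theorem arccos_add_arccos_add_arccos {x y z : ℝ} (hx : 0 < x) (hy : 0 < y) (hz : 0 < z)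
    (hxyz : x ≤ y + z) (hyzx : y ≤ z + x) (hzxy : z ≤ x + y) :
    Real.arccos ((y ^ 2 + z ^ 2 - x ^ 2) / (2 * y * z))
      + Real.arccos ((z ^ 2 + x ^ 2 - y ^ 2) / (2 * z * x))
      + Real.arccos ((x ^ 2 + y ^ 2 - z ^ 2) / (2 * x * y)) = Real.pi := by
  set P := (y ^ 2 + z ^ 2 - x ^ 2) / (2 * y * z) with hP
  set Q := (z ^ 2 + x ^ 2 - y ^ 2) / (2 * z * x) with hQ
  set R := (x ^ 2 + y ^ 2 - z ^ 2) / (2 * x * y) with hR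
  have hP1 : -1 ≤ P ∧ P ≤ 1 := by
    constructor
    · rw [hP, le_div_iff₀ (by positivity)]; nlinarith
    · rw [hP, div_le_iff₀ (by positivity)]; nlinarith
  have hQ1 : -1 ≤ Q ∧ Q ≤ 1 := by
    constructor
    · rw [hQ, le_div_iff₀ (by positivity)]; nlinarith
    · rw [hQ, div_le_iff₀ (by positivity)]; nlinarith
  have hPQ : 0 ≤ P + Q := by
    have : P + Q = (x + y) * ((z + x - y) * (z + y - x)) / (2 * x * y * z) := by
      rw [hP, hQ]; field_simp; ring
    rw [this]
    have h1 : 0 ≤ z + x - y := by linarith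
    have h2 : 0 ≤ z + y - x := by linarith
    positivity
  have hPQR : 0 ≤ P * Q + R := by
    have : P * Q + R
        = (x + y + z) * ((y + z - x) * (z + x - y) * (x + y - z)) / (4 * x * y * z ^ 2) := by
      rw [hP, hQ, hR]; field_simp; ring
    rw [this]
    have h1 : 0 ≤ z + x - y := by linarith
    have h2 : 0 ≤ y + z - x := by linarith
    have h3 : 0 ≤ x + y - z := by linarith
    positivity
  have hsq : (1 - P ^ 2) * (1 - Q ^ 2) = (P * Q + R) ^ 2 := by
    rw [hP, hQ, hR]; field_simp; ring
  have hle : Real.arccos P + Real.arccos Q ≤ Real.pi := by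
    have := Real.arccos_le_arccos (show -P ≤ Q by linarith)
    rw [Real.arccos_neg] at this
    linarith
  have hsum : Real.arccos P + Real.arccos Q = Real.arccos (-R) := by
    rw [← Real.arccos_cos (add_nonneg (Real.arccos_nonneg P) (Real.arccos_nonneg Q)) hle,
      Real.cos_add, Real.cos_arccos hP1.1 hP1.2, Real.cos_arccos hQ1.1 hQ1.2, Real.sin_arccos,
      Real.sin_arccos, ← Real.sqrt_mul (by nlinarith), hsq, Real.sqrt_sq hPQR]
    congr 1
    ring
  rw [hsum, Real.arccos_neg]
  ring

theorem arccos_eq_pi_of_degenerate {x y z : ℝ} (hy : 0 < y) (hz : 0 < z) (h : y + z ≤ x) :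
    Real.arccos ((y ^ 2 + z ^ 2 - x ^ 2) / (2 * y * z)) = Real.pi := by
  rw [Real.arccos_eq_pi, div_le_iff₀ (by positivity)]
  nlinarith

theorem arccos_eq_zero_of_degenerate {x y z : ℝ} (hx : 0 < x) (hy : 0 < y) (hz : 0 < z)
    (h : x + y ≤ z ∨ x + z ≤ y) :
    Real.arccos ((y ^ 2 + z ^ 2 - x ^ 2) / (2 * y * z)) = 0 := by
  rw [Real.arccos_eq_zero, le_div_iff₀ (by positivity)]
  rcases h with h | h <;> nlinarith

section QuadraticForm

variable {A₁ A₂ A₃ y₁ y₂ y₃ L₁ L₂ L₃ n₁ n₂ n₃ : ℝ}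

/-- With nᵢ/Lᵢ as coefficients of the angle form, the left side is their second symmetric function
times L₁L₂L₃. The last factor on the right is an eighth of the Jacobian of the squared lengths. -/
theorem mixed_sum_eq 
    (hL₁ : L₁ = A₂ + A₃ + 2 * y₁) (hL₂ : L₂ = A₁ + A₃ + 2 * y₂) (hL₃ : L₃ = A₁ + A₂ + 2 * y₃)
    (hn₁ : n₁ = A₂ * A₃ - y₁ ^ 2 + (A₂ * y₂ + y₁ * y₃) + (A₃ * y₃ + y₁ * y₂))
    (hn₂ : n₂ = A₁ * A₃ - y₂ ^ 2 + (A₁ * y₁ + y₂ * y₃) + (A₃ * y₃ + y₁ * y₂))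
    (hn₃ : n₃ = A₁ * A₂ - y₃ ^ 2 + (A₁ * y₁ + y₂ * y₃) + (A₂ * y₂ + y₁ * y₃)) :
    n₁ * n₂ * L₃ + n₂ * n₃ * L₁ + n₁ * n₃ * L₂ = (n₁ + n₂ + n₃) *
      ((A₁ + y₃) * (A₂ + y₁) * (A₃ + y₂) + (A₁ + y₂) * (A₂ + y₃) * (A₃ + y₁)) := by
  subst_vars
  ring

/-- The right side is sixteen times the squared area, which fixes the sign of n₁ + n₂ + n₃. -/
theorem four_mul_sum_eq
    (hL₁ : L₁ = A₂ + A₃ + 2 * y₁) (hL₂ : L₂ = A₁ + A₃ + 2 * y₂) (hL₃ : L₃ = A₁ + A₂ + 2 * y₃)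
    (hn₁ : n₁ = A₂ * A₃ - y₁ ^ 2 + (A₂ * y₂ + y₁ * y₃) + (A₃ * y₃ + y₁ * y₂))
    (hn₂ : n₂ = A₁ * A₃ - y₂ ^ 2 + (A₁ * y₁ + y₂ * y₃) + (A₃ * y₃ + y₁ * y₂))
    (hn₃ : n₃ = A₁ * A₂ - y₃ ^ 2 + (A₁ * y₁ + y₂ * y₃) + (A₂ * y₂ + y₁ * y₃)) :
    4 * (n₁ + n₂ + n₃) = 4 * L₂ * L₃ - (L₂ + L₃ - L₁) ^ 2 := by
  subst_vars
  ring

theorem sum_angle_deriv_eq (h1 : L₁ ≠ 0) (h2 : L₂ ≠ 0) (h3 : L₃ ≠ 0)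
    (hL₁ : L₁ = A₂ + A₃ + 2 * y₁) (hL₂ : L₂ = A₁ + A₃ + 2 * y₂) (hL₃ : L₃ = A₁ + A₂ + 2 * y₃)
    (hn₁ : n₁ = A₂ * A₃ - y₁ ^ 2 + (A₂ * y₂ + y₁ * y₃) + (A₃ * y₃ + y₁ * y₂))
    (hn₂ : n₂ = A₁ * A₃ - y₂ ^ 2 + (A₁ * y₁ + y₂ * y₃) + (A₃ * y₃ + y₁ * y₂))
    (hn₃ : n₃ = A₁ * A₂ - y₃ ^ 2 + (A₁ * y₁ + y₂ * y₃) + (A₂ * y₂ + y₁ * y₃))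
    {L₁' L₂' L₃' v₁ v₂ v₃ : ℝ}
    (hL₁' : L₁' = 2 * (v₂ * (A₂ + y₁) + v₃ * (A₃ + y₁)))
    (hL₂' : L₂' = 2 * (v₁ * (A₁ + y₂) + v₃ * (A₃ + y₂)))
    (hL₃' : L₃' = 2 * (v₁ * (A₁ + y₃) + v₂ * (A₂ + y₃))) :
    v₁ * (L₁' - (L₁ + L₂ - L₃) / (2 * L₂) * L₂' - (L₁ + L₃ - L₂) / (2 * L₃) * L₃')
      + v₂ * (L₂' - (L₂ + L₃ - L₁) / (2 * L₃) * L₃' - (L₂ + L₁ - L₃) / (2 * L₁) * L₁')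
      + v₃ * (L₃' - (L₃ + L₁ - L₂) / (2 * L₁) * L₁' - (L₃ + L₂ - L₁) / (2 * L₂) * L₂')
      = -(2 * (n₁ / L₁ * (v₂ - v₃) ^ 2 + n₂ / L₂ * (v₁ - v₃) ^ 2 + n₃ / L₃ * (v₁ - v₂) ^ 2)) := by
  obtain rfl : y₁ = (L₁ - A₂ - A₃) / 2 := by linarith
  obtain rfl : y₂ = (L₂ - A₁ - A₃) / 2 := by linarith
  obtain rfl : y₃ = (L₃ - A₁ - A₂) / 2 := by linarith
  rw [hn₁, hn₂, hn₃, hL₁', hL₂', hL₃']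
  field_simp
  ring

/-- A quadratic form in the differences of three variables is definite if its minor `σ` and its
value at the vertices of a nondegenerate triangle are positive. -/
theorem form_nonneg {m₁ m₂ m₃ : ℝ} (hL₁ : 0 < L₁)
    (hL₂ : 0 < L₂)
    (hS : 0 < 4 * L₂ * L₃ - (L₂ + L₃ - L₁) ^ 2) (hn : 0 < m₁ * L₁ + m₂ * L₂ + m₃ * L₃)
    (hσ : 0 < m₁ * m₂ + m₂ * m₃ + m₁ * m₃) (v₁ v₂ v₃ : ℝ) :
    0 ≤ m₁ * (v₂ - v₃) ^ 2 + m₂ * (v₁ - v₃) ^ 2 + m₃ * (v₁ - v₂) ^ 2 ∧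
    (m₁ * (v₂ - v₃) ^ 2 + m₂ * (v₁ - v₃) ^ 2 + m₃ * (v₁ - v₂) ^ 2 = 0 → v₁ = v₃ ∧ v₂ = v₃) := by
  -- This is the leading coefficient of the form in v₁ - v₃ and v₂ - v₃. Its product with the
  -- positive sum of the mᵢLᵢ is σL₁ plus a form in m₂, m₃ that is semidefinite by `hS`.
  have hs : 0 < m₂ + m₃ := by
    have h1 : (m₂ + m₃) * (m₁ * L₁ + m₂ * L₂ + m₃ * L₃)
        = (m₁ * m₂ + m₂ * m₃ + m₁ * m₃) * L₁
          + (m₂ ^ 2 * L₂ + m₃ ^ 2 * L₃ + m₂ * m₃ * (L₂ + L₃ - L₁)) := by ring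
    have h2 : 0 ≤ m₂ ^ 2 * L₂ + m₃ ^ 2 * L₃ + m₂ * m₃ * (L₂ + L₃ - L₁) := by
      have h3 : 0 ≤ 4 * L₂ * (m₂ ^ 2 * L₂ + m₃ ^ 2 * L₃ + m₂ * m₃ * (L₂ + L₃ - L₁)) := by
        nlinarith [sq_nonneg (2 * L₂ * m₂ + m₃ * (L₂ + L₃ - L₁)), mul_nonneg (sq_nonneg m₃) hS.le]
      exact nonneg_of_mul_nonneg_right h3 (by positivity)
    have h4 : 0 < (m₂ + m₃) * (m₁ * L₁ + m₂ * L₂ + m₃ * L₃) := by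
      rw [h1]
      positivity
    exact (pos_iff_pos_of_mul_pos h4).2 hn
  have key : (m₂ + m₃) * (m₁ * (v₂ - v₃) ^ 2 + m₂ * (v₁ - v₃) ^ 2 + m₃ * (v₁ - v₂) ^ 2)
      = ((m₂ + m₃) * (v₁ - v₃) - m₃ * (v₂ - v₃)) ^ 2
        + (m₁ * m₂ + m₂ * m₃ + m₁ * m₃) * (v₂ - v₃) ^ 2 := by ring
  refine ⟨?_, fun h => ?_⟩
  · have : 0 ≤ (m₂ + m₃) * (m₁ * (v₂ - v₃) ^ 2 + m₂ * (v₁ - v₃) ^ 2 + m₃ * (v₁ - v₂) ^ 2) := by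
      rw [key]
      positivity
    exact nonneg_of_mul_nonneg_right this hs
  · rw [h, mul_zero] at key
    have h1 := mul_nonneg hσ.le (sq_nonneg (v₂ - v₃))
    have h2 : (v₂ - v₃) ^ 2 = 0 := by
      have : (m₁ * m₂ + m₂ * m₃ + m₁ * m₃) * (v₂ - v₃) ^ 2 = 0 := by
        linarith [sq_nonneg ((m₂ + m₃) * (v₁ - v₃) - m₃ * (v₂ - v₃))]
      exact (mul_eq_zero.1 this).resolve_left hσ.ne'
    have h3 : v₂ - v₃ = 0 := by simpa using h2
    rw [h3] at key
    have h4 : (m₂ + m₃) * (v₁ - v₃) = 0 := by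
      have : ((m₂ + m₃) * (v₁ - v₃)) ^ 2 = 0 := by linarith
      simpa using this
    have h5 := (mul_eq_zero.1 h4).resolve_left hs.ne'
    exact ⟨by linarith, by linarith⟩

end QuadraticForm

/-! ### Positivity of the Jacobian from the structure conditions -/

section Minor

variable {x₁ x₂ x₃ e₁ e₂ e₃ η₁ η₂ η₃ : ℝ}

/-- A negative η₁ forces e₂ = e₃ = 1 and then η₂η₃ > 0. The polynomial becomes a sum of terms
carrying the structure conditions as factors, the first of them strictly positive. -/
theorem minor_pos_of_neg (hx₁ : 0 < x₁) (hx₂ : 0 < x₂) (hx₃ : 0 < x₃)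
    (he₁ : e₁ = 0 ∨ e₁ = 1) (he₂ : e₂ = 0 ∨ e₂ = 1) (he₃ : e₃ = 0 ∨ e₃ = 1)
    (h₁ : 0 < e₂ * e₃ + η₁) (h₂ : 0 < e₁ * e₃ + η₂) (h₃ : 0 < e₁ * e₂ + η₃)
    (f₁ : 0 ≤ e₁ * η₁ + η₂ * η₃) (f₂ : 0 ≤ e₂ * η₂ + η₁ * η₃) (f₃ : 0 ≤ e₃ * η₃ + η₁ * η₂)
    (hη : η₁ < 0) :
    0 < (e₁ * x₁ ^ 2 + η₃ * (x₁ * x₂)) * (e₂ * x₂ ^ 2 + η₁ * (x₂ * x₃))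
          * (e₃ * x₃ ^ 2 + η₂ * (x₁ * x₃))
        + (e₁ * x₁ ^ 2 + η₂ * (x₁ * x₃)) * (e₂ * x₂ ^ 2 + η₃ * (x₁ * x₂))
          * (e₃ * x₃ ^ 2 + η₁ * (x₂ * x₃)) := by
  obtain rfl : e₂ = 1 := he₂.resolve_left fun h => by rw [h] at h₁; linarith
  obtain rfl : e₃ = 1 := he₃.resolve_left fun h => by rw [h] at h₁; linarith
  have he : 0 ≤ e₁ := by rcases he₁ with rfl | rfl <;> norm_num
  have hη₂₃ : 0 < η₂ * η₃ := by
    rcases he₁ with rfl | rfl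
    · exact mul_pos (by linarith) (by linarith)
    · linarith
  have key : (e₁ * x₁ ^ 2 + η₃ * (x₁ * x₂)) * (1 * x₂ ^ 2 + η₁ * (x₂ * x₃))
          * (1 * x₃ ^ 2 + η₂ * (x₁ * x₃))
        + (e₁ * x₁ ^ 2 + η₂ * (x₁ * x₃)) * (1 * x₂ ^ 2 + η₃ * (x₁ * x₂))
          * (1 * x₃ ^ 2 + η₁ * (x₂ * x₃))
      = 2 * (1 + η₁) * (x₁ * x₂ * x₃) ^ 2 * (e₁ + η₂ * η₃)
        + (e₁ * η₁ + η₂ * η₃) * (x₁ ^ 2 * x₂ * x₃ * (x₂ - x₃) ^ 2)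
        + (1 * η₂ + η₁ * η₃) * (x₁ * x₂ ^ 2 * x₃ * (e₁ * x₁ ^ 2 + x₃ ^ 2))
        + (1 * η₃ + η₁ * η₂) * (x₁ * x₂ * x₃ ^ 2 * (e₁ * x₁ ^ 2 + x₂ ^ 2)) := by ring
  rw [key]
  have h₁' : 0 < 1 + η₁ := by linarith
  positivity

theorem partial_pos {x y e e' η : ℝ} (hx : 0 < x) (hy : 0 < y) (he : e = 0 ∨ e = 1)
    (h : 0 < e * e' + η) (hη : 0 ≤ η) : 0 < e * x ^ 2 + η * (x * y) := by
  rcases he with rfl | rfl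
  · have : 0 < η := by linarith
    positivity
  · positivity

/-- The determinant of the derivative of the squared lengths is positive. -/
theorem minor_pos (hx₁ : 0 < x₁) (hx₂ : 0 < x₂) (hx₃ : 0 < x₃)
    (he₁ : e₁ = 0 ∨ e₁ = 1) (he₂ : e₂ = 0 ∨ e₂ = 1) (he₃ : e₃ = 0 ∨ e₃ = 1)
    (h₁ : 0 < e₂ * e₃ + η₁) (h₂ : 0 < e₁ * e₃ + η₂) (h₃ : 0 < e₁ * e₂ + η₃)
    (f₁ : 0 ≤ e₁ * η₁ + η₂ * η₃) (f₂ : 0 ≤ e₂ * η₂ + η₁ * η₃) (f₃ : 0 ≤ e₃ * η₃ + η₁ * η₂) :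
    0 < (e₁ * x₁ ^ 2 + η₃ * (x₁ * x₂)) * (e₂ * x₂ ^ 2 + η₁ * (x₂ * x₃))
          * (e₃ * x₃ ^ 2 + η₂ * (x₁ * x₃))
        + (e₁ * x₁ ^ 2 + η₂ * (x₁ * x₃)) * (e₂ * x₂ ^ 2 + η₃ * (x₁ * x₂))
          * (e₃ * x₃ ^ 2 + η₁ * (x₂ * x₃)) := by
  rcases lt_or_ge η₁ 0 with g₁ | g₁
  · exact minor_pos_of_neg hx₁ hx₂ hx₃ he₁ he₂ he₃ h₁ h₂ h₃ f₁ f₂ f₃ g₁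
  rcases lt_or_ge η₂ 0 with g₂ | g₂
  · have := minor_pos_of_neg hx₂ hx₁ hx₃ he₂ he₁ he₃ h₂ h₁ (by linarith) f₂ f₁ (by linarith) g₂
    linarith
  rcases lt_or_ge η₃ 0 with g₃ | g₃
  · have := minor_pos_of_neg (η₂ := η₂) (η₃ := η₁) hx₃ hx₂ hx₁ he₃ he₂ he₁ (by linarith) (by linarith) (by linarith)
      (by linarith) (by linarith) (by linarith) g₃
    linarith
  · have p₁ := partial_pos hx₁ hx₂ he₁ h₃ g₃
    have p₂ := partial_pos hx₂ hx₃ he₂ h₁ g₁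
    have p₃ := partial_pos hx₃ hx₁ he₃ (mul_comm e₁ e₃ ▸ h₂) g₂
    have q₁ := partial_pos hx₁ hx₃ he₁ h₂ g₂
    have q₂ := partial_pos hx₂ hx₁ he₂ (mul_comm e₁ e₂ ▸ h₃) g₃
    have q₃ := partial_pos hx₃ hx₂ he₃ (mul_comm e₂ e₃ ▸ h₁) g₁
    rw [mul_comm x₃ x₁] at p₃
    rw [mul_comm x₂ x₁] at q₂
    rw [mul_comm x₃ x₂] at q₃
    positivity

end Minor

/-- A continuous function on the line is antitone if it has nonpositive derivatives outside of a
set on which it takes finitely many values. -/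
theorem antitone_of_finite_image_compl {g : ℝ → ℝ} (hg : Continuous g) (U : Set ℝ)
    (hU : ∀ s ∈ U, ∃ g', HasDerivAt g g' s ∧ g' ≤ 0) (hfin : (g '' Uᶜ).Finite) : Antitone g := by
  intro a b hab
  by_contra! hlt
  obtain ⟨y, hy⟩ : (Ioo (g a) (g b) \ (g '' Uᶜ)).Nonempty :=
    ((Ioo_infinite hlt).sdiff hfin).nonempty
  have hopen : IsOpen (Ioo (g a) (g b) \ (g '' Uᶜ)) := isOpen_Ioo.sdiff hfin.isClosed
  obtain ⟨δ, hδ, hball⟩ := Metric.isOpen_iff.1 hopen y hy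
  rw [Real.ball_eq_Ioo] at hball
  have hz : y + δ / 2 ∈ Ioo (g a) (g b) := (hball ⟨by linarith, by linarith⟩).1
  -- The values from y to y + δ / 2 avoid the exceptional ones. Between the last time g ≤ y and the
  -- next time g ≥ y + δ / 2, only points of U occur, yet g would increase.
  obtain ⟨s₁, hs₁, hmax⟩ := ((isCompact_Icc (a := a) (b := b)).inter_right
    (isClosed_le hg (continuous_const (y := y)))).exists_isGreatest
    ⟨a, left_mem_Icc.2 hab, hy.1.1.le⟩
  obtain ⟨s₂, hs₂, hmin⟩ := ((isCompact_Icc (a := s₁) (b := b)).inter_right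
    (isClosed_le (continuous_const (y := y + δ / 2)) hg)).exists_isLeast
    ⟨b, right_mem_Icc.2 hs₁.1.2, hz.2.le⟩
  have hmem : ∀ s ∈ Ioo s₁ s₂, s ∈ U := by
    intro s hs
    by_contra hsU
    have h1 : y < g s := by
      by_contra! h
      exact hs.1.not_ge (hmax ⟨⟨hs₁.1.1.trans hs.1.le, hs.2.le.trans hs₂.1.2⟩, h⟩)
    have h2 : g s < y + δ / 2 := by
      by_contra! h
      exact hs.2.not_ge (hmin ⟨⟨hs.1.le, hs.2.le.trans hs₂.1.2⟩, h⟩)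
    exact (hball ⟨by linarith, by linarith⟩ : g s ∈ _).2 ⟨s, hsU, rfl⟩
  have hanti : AntitoneOn g (Icc s₁ s₂) := by
    refine antitoneOn_of_deriv_nonpos (convex_Icc _ _) hg.continuousOn ?_ ?_
    · intro s hs
      rw [interior_Icc] at hs
      obtain ⟨g', hg', _⟩ := hU s (hmem s hs)
      exact hg'.differentiableAt.differentiableWithinAt
    · intro s hs
      rw [interior_Icc] at hs
      obtain ⟨g', hg', hle⟩ := hU s (hmem s hs)
      rwa [hg'.deriv]
  have h1 := hanti (left_mem_Icc.2 hs₂.1.1) (right_mem_Icc.2 hs₂.1.1) hs₂.1.1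
  have h2 : g s₁ ≤ y := hs₁.2
  have h3 : y + δ / 2 ≤ g s₂ := hs₂.2
  linarith

end Triangle

/-! ### Angles of a single weighted triangle as functions of its conformal factors -/

namespace Triangle

/-- Weights at the corners and sides of a single triangle that satisfy the structure conditions. -/
structure IsStructured (e n : Fin 3 → ℝ) : Prop where
  zero_or_one : ∀ a, e a = 0 ∨ e a = 1
  edge_pos : ∀ a, 0 < e (a + 1) * e (a + 2) + n a
  face_nonneg : ∀ a, 0 ≤ e a * n a + n (a + 1) * n (a + 2)

/-- The square of the length of the side opposite to the corner `a`. -/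
def sqLength (e n x : Fin 3 → ℝ) (a : Fin 3) : ℝ :=
  e (a + 1) * Real.exp (2 * x (a + 1)) + e (a + 2) * Real.exp (2 * x (a + 2))
    + 2 * n a * Real.exp (x (a + 1) + x (a + 2))

/-- The angle at the corner `a` by the law of cosines. As `Real.arccos` is constant outside of
`[-1, 1]`, this includes the extension by constants to degenerate triangles. -/
def cornerAngle (e n x : Fin 3 → ℝ) (a : Fin 3) : ℝ :=
  Real.arccos ((√(sqLength e n x (a + 1)) ^ 2 + √(sqLength e n x (a + 2)) ^ 2
    - √(sqLength e n x a) ^ 2) / (2 * √(sqLength e n x (a + 1)) * √(sqLength e n x (a + 2))))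

/-- The triangle is nondegenerate. -/
def Nondegenerate (e n x : Fin 3 → ℝ) : Prop :=
  ∀ a, 0 < √(sqLength e n x a) ∧
    √(sqLength e n x a) < √(sqLength e n x (a + 1)) + √(sqLength e n x (a + 2))

theorem forall_fin_three {p : Fin 3 → Prop} : (∀ a, p a) ↔ p 0 ∧ p 1 ∧ p 2 :=
  ⟨fun h => ⟨h 0, h 1, h 2⟩, fun h a => by fin_cases a <;> simp [h]⟩

variable {e n : Fin 3 → ℝ} (h : IsStructured e n)
include h

/-- As the weights are 0 or 1, the two squares dominate twice their mixed product, leaving at least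
2(e e' + n) times a product of exponentials. -/
theorem sqLength_pos (x : Fin 3 → ℝ) (a : Fin 3) : 0 < sqLength e n x a := by
  have key : sqLength e n x a = e (a + 1) * Real.exp (x (a + 1)) ^ 2
      + e (a + 2) * Real.exp (x (a + 2)) ^ 2
      + 2 * n a * (Real.exp (x (a + 1)) * Real.exp (x (a + 2))) := by
    rw [sqLength, Real.exp_add, ← Real.exp_nat_mul, ← Real.exp_nat_mul]
    norm_num
  rw [key]
  have hp := Real.exp_pos (x (a + 1))
  have hq := Real.exp_pos (x (a + 2))
  have hpq := mul_pos hp hq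
  have hn := h.edge_pos a
  have h1 := mul_pos hn hpq
  rcases h.zero_or_one (a + 1) with h₁ | h₁ <;> rcases h.zero_or_one (a + 2) with h₂ | h₂ <;>
    rw [h₁, h₂] at h1 ⊢ <;>
    nlinarith [sq_nonneg (Real.exp (x (a + 1)) - Real.exp (x (a + 2)))]

theorem sqrt_sqLength_pos (x : Fin 3 → ℝ) (a : Fin 3) : 0 < √(sqLength e n x a) :=
  Real.sqrt_pos.2 (sqLength_pos h x a)

theorem continuous_cornerAngle (a : Fin 3) : Continuous fun x => cornerAngle e n x a := by
  have hc : ∀ b, Continuous fun x => √(sqLength e n x b) := fun b => by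
    unfold sqLength
    fun_prop
  unfold cornerAngle
  refine Real.continuous_arccos.comp (Continuous.div ?_ ?_ fun x => ?_)
  · exact (((hc _).pow 2).add ((hc _).pow 2)).sub ((hc _).pow 2)
  · exact (continuous_const.mul (hc _)).mul (hc _)
  · exact (mul_pos (mul_pos two_pos (sqrt_sqLength_pos h x _)) (sqrt_sqLength_pos h x _)).ne'

theorem cornerAngle_eq (x : Fin 3 → ℝ) (a : Fin 3) :
    cornerAngle e n x a = Real.arccos ((sqLength e n x (a + 1) + sqLength e n x (a + 2)
      - sqLength e n x a) / (2 * √(sqLength e n x (a + 1)) * √(sqLength e n x (a + 2)))) := by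
  rw [cornerAngle, Real.sq_sqrt (sqLength_pos h x _).le, Real.sq_sqrt (sqLength_pos h x _).le,
    Real.sq_sqrt (sqLength_pos h x _).le]

/-- The values of the angles in a degenerate triangle. -/
theorem cornerAngle_of_degenerate {x : Fin 3 → ℝ} (hx : ¬ Nondegenerate e n x) (a : Fin 3) :
    cornerAngle e n x a =
      if √(sqLength e n x (a + 1)) + √(sqLength e n x (a + 2)) ≤ √(sqLength e n x a)
      then Real.pi else 0 := by
  have hpos := sqrt_sqLength_pos h x
  split_ifs with hle
  · exact arccos_eq_pi_of_degenerate (hpos _) (hpos _) hle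
  · refine arccos_eq_zero_of_degenerate (hpos _) (hpos _) (hpos _) ?_
    unfold Nondegenerate at hx
    push Not at hx
    obtain ⟨b, hb⟩ := hx
    replace hb := hb (hpos b)
    fin_cases a <;> fin_cases b <;> simp_all [add_comm] <;> grind

/-- The angles of a triangle sum up to `π`, also in a degenerate triangle. -/
theorem sum_cornerAngle (x : Fin 3 → ℝ) : ∑ a, cornerAngle e n x a = Real.pi := by
  have hpos := sqrt_sqLength_pos h x
  by_cases hx : Nondegenerate e n x
  · have h0 := (hx 0).2
    have h1 := (hx 1).2
    have h2 := (hx 2).2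
    rw [Fin.sum_univ_three]
    exact arccos_add_arccos_add_arccos (hpos 0) (hpos 1) (hpos 2) h0.le h1.le h2.le
  · rw [Fin.sum_univ_three]
    simp only [cornerAngle_of_degenerate h hx]
    have h0 := hpos 0
    have h1 := hpos 1
    have h2 := hpos 2
    unfold Nondegenerate at hx
    rw [forall_fin_three] at hx
    simp only [h0, h1, h2, true_and, Fin.isValue, zero_add, Fin.reduceAdd] at hx ⊢
    split_ifs <;> first
      | (exfalso; linarith)
      | exact absurd ⟨by linarith, by linarith, by linarith⟩ hx
      | simp

theorem heron_pos {x : Fin 3 → ℝ} (hx : Nondegenerate e n x) (a : Fin 3) :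
    0 < 4 * sqLength e n x (a + 1) * sqLength e n x (a + 2)
      - (sqLength e n x (a + 1) + sqLength e n x (a + 2) - sqLength e n x a) ^ 2 := by
  have key : ∀ x y z : ℝ, 0 < x → 0 < y → 0 < z → x < y + z → y < z + x → z < x + y →
      0 < 4 * y ^ 2 * z ^ 2 - (y ^ 2 + z ^ 2 - x ^ 2) ^ 2 := by
    intro x y z hx hy hz h1 h2 h3
    have : 4 * y ^ 2 * z ^ 2 - (y ^ 2 + z ^ 2 - x ^ 2) ^ 2
        = (x + y + z) * ((y + z - x) * (z + x - y) * (x + y - z)) := by ring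
    rw [this]
    have h1' : 0 < y + z - x := by linarith
    have h2' : 0 < z + x - y := by linarith
    have h3' : 0 < x + y - z := by linarith
    positivity
  have hsq := fun b => Real.sq_sqrt (sqLength_pos h x b).le
  rw [← hsq a, ← hsq (a + 1), ← hsq (a + 2)]
  have h1 := (hx (a + 1)).2
  have h2 := (hx (a + 2)).2
  refine key _ _ _ (hx a).1 (hx (a + 1)).1 (hx (a + 2)).1 (hx a).2 ?_ ?_
  · rw [add_assoc, add_assoc] at h1
    simpa using h1
  · rw [add_assoc, add_assoc] at h2
    simpa [show (2 + 2 : Fin 3) = 1 from rfl] using h2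

theorem differentiableAt_cornerAngle {x : Fin 3 → ℝ} (hx : Nondegenerate e n x) (a : Fin 3) :
    DifferentiableAt ℝ (fun x => cornerAngle e n x a) x := by
  have hd : ∀ b, DifferentiableAt ℝ (fun x => sqLength e n x b) x := fun b => by
    unfold sqLength
    fun_prop
  have hS := heron_pos h hx a
  simp only [cornerAngle_eq h]
  have hb := sqLength_pos h x (a + 1)
  have hc := sqLength_pos h x (a + 2)
  have hβ := Real.sqrt_pos.2 hb
  have hγ := Real.sqrt_pos.2 hc
  have hlt : ((sqLength e n x (a + 1) + sqLength e n x (a + 2) - sqLength e n x a)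
      / (2 * √(sqLength e n x (a + 1)) * √(sqLength e n x (a + 2)))) ^ 2 < 1 := by
    rw [div_pow, div_lt_one (by positivity), mul_pow, mul_pow, Real.sq_sqrt hb.le,
      Real.sq_sqrt hc.le]
    linarith
  have hquot : DifferentiableAt ℝ (fun x => (sqLength e n x (a + 1) + sqLength e n x (a + 2)
      - sqLength e n x a) / (2 * √(sqLength e n x (a + 1)) * √(sqLength e n x (a + 2)))) x := by
    simp only [div_eq_mul_inv]
    refine (((hd _).add (hd _)).sub (hd _)).fun_mul (DifferentiableAt.fun_inv ?_ ?_)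
    · exact (((hd _).sqrt hb.ne').const_mul 2).mul ((hd _).sqrt hc.ne')
    · exact (mul_pos (mul_pos two_pos hβ) hγ).ne'
  have harccos : DifferentiableAt ℝ Real.arccos ((sqLength e n x (a + 1) + sqLength e n x (a + 2)
      - sqLength e n x a) / (2 * √(sqLength e n x (a + 1)) * √(sqLength e n x (a + 2)))) := by
    refine Real.differentiableAt_arccos.2 ⟨fun h => ?_, fun h => ?_⟩ <;>
    · rw [h] at hlt
      norm_num at hlt
  exact DifferentiableAt.comp (g := Real.arccos) x harccos hquot

/-- Along a line, the derivative of the angles is negative semidefinite at a nondegenerate triangle,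
and its kernel consists of the constant vectors. -/
theorem exists_hasDerivAt_sum_cornerAngle (x v : Fin 3 → ℝ) {s : ℝ}
    (hs : Nondegenerate e n (x + s • v)) :
    ∃ q, HasDerivAt (fun s : ℝ => ∑ a, v a * cornerAngle e n (x + s • v) a) q s ∧ q ≤ 0 ∧
      (q = 0 → ∀ a b, v a = v b) := by
  set X : Fin 3 → ℝ := x + s • v with hX
  set p : Fin 3 → ℝ := fun a => Real.exp (X a) with hp
  have hp0 : ∀ a, 0 < p a := fun a => Real.exp_pos _
  have hL : ∀ a, sqLength e n X a = e (a + 1) * p (a + 1) ^ 2 + e (a + 2) * p (a + 2) ^ 2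
      + 2 * (n a * (p (a + 1) * p (a + 2))) := fun a => by
    rw [sqLength, Real.exp_add, hp, ← Real.exp_nat_mul, ← Real.exp_nat_mul]
    push_cast
    ring
  have hdL : ∀ a, HasDerivAt (fun s : ℝ => sqLength e n (x + s • v) a)
      (2 * (v (a + 1) * (e (a + 1) * p (a + 1) ^ 2 + n a * (p (a + 1) * p (a + 2)))
        + v (a + 2) * (e (a + 2) * p (a + 2) ^ 2 + n a * (p (a + 1) * p (a + 2))))) s := by
    intro a
    have hlin : ∀ b, HasDerivAt (fun s : ℝ => (x + s • v) b) (v b) s := fun b => by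
      simpa using ((hasDerivAt_id s).mul_const (v b)).const_add (x b)
    have h1 := ((((hlin (a + 1)).const_mul 2).exp.const_mul (e (a + 1))).add
      (((hlin (a + 2)).const_mul 2).exp.const_mul (e (a + 2)))).add
      (((hlin (a + 1)).add (hlin (a + 2))).exp.const_mul (2 * n a))
    refine h1.congr_deriv ?_
    have h2 : ∀ b, Real.exp (2 * (x + s • v) b) = p b ^ 2 := fun b => by
      rw [hp, ← Real.exp_nat_mul]
      norm_num [hX]
    rw [h2, h2]
    simp only [Pi.add_apply (f := fun s : ℝ => (x + s • v) (a + 1))]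
    rw [Real.exp_add]
    change _ + _ + 2 * n a * (p (a + 1) * p (a + 2) * _) = _
    ring
  have hpos := sqLength_pos h X
  have hS := heron_pos h hs
  have hθ := fun a => hasDerivAt_arccos_of_sq (hdL a) (hdL (a + 1)) (hdL (a + 2)) (hpos (a + 1))
    (hpos (a + 2)) (hS a)
  simp only [← cornerAngle_eq h] at hθ
  have hsum := HasDerivAt.fun_sum (u := Finset.univ) fun a _ => (hθ a).const_mul (v a)
  have e₁ : 0 < e 0 * e 2 + n 1 := by simpa [mul_comm] using h.edge_pos 1
  have f₁ : 0 ≤ e 1 * n 1 + n 0 * n 2 := by simpa [mul_comm] using h.face_nonneg 1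
  have hm := minor_pos (hp0 0) (hp0 1) (hp0 2) (h.zero_or_one 0) (h.zero_or_one 1)
    (h.zero_or_one 2) (h.edge_pos 0) e₁ (h.edge_pos 2) (h.face_nonneg 0) f₁ (h.face_nonneg 2)
  have g₀ : 0 < 4 * sqLength e n X 1 * sqLength e n X 2
    - (sqLength e n X 1 + sqLength e n X 2 - sqLength e n X 0) ^ 2 := hS 0
  set S := √(4 * sqLength e n X 1 * sqLength e n X 2
    - (sqLength e n X 1 + sqLength e n X 2 - sqLength e n X 0) ^ 2) with hSdef
  have hS0 : 0 < S := Real.sqrt_pos.2 g₀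
  have hS1 : √(4 * sqLength e n X 2 * sqLength e n X 0
    - (sqLength e n X 2 + sqLength e n X 0 - sqLength e n X 1) ^ 2) = S := by
    rw [hSdef]; congr 1; ring
  have hS2 : √(4 * sqLength e n X 0 * sqLength e n X 1
    - (sqLength e n X 0 + sqLength e n X 1 - sqLength e n X 2) ^ 2) = S := by
    rw [hSdef]; congr 1; ring
  have hL0 : sqLength e n X 0 = e 1 * p 1 ^ 2 + e 2 * p 2 ^ 2 + 2 * (n 0 * (p 1 * p 2)) := hL 0
  have hL1 : sqLength e n X 1 = e 0 * p 0 ^ 2 + e 2 * p 2 ^ 2 + 2 * (n 1 * (p 0 * p 2)) :=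
    (hL 1).trans (by simp only [Fin.isValue, Fin.reduceAdd]; ring)
  have hL2 : sqLength e n X 2 = e 0 * p 0 ^ 2 + e 1 * p 1 ^ 2 + 2 * (n 2 * (p 0 * p 1)) := hL 2
  have p0 : 0 < sqLength e n X 0 := hpos 0
  have p1 : 0 < sqLength e n X 1 := hpos 1
  have p2 : 0 < sqLength e n X 2 := hpos 2
  rw [Fin.sum_univ_three] at hsum
  simp only [Fin.isValue, zero_add, Fin.reduceAdd, hS1, hS2, ← hSdef, ← hX] at hsum
  generalize sqLength e n X 0 = L₁ at *
  generalize sqLength e n X 1 = L₂ at *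
  generalize sqLength e n X 2 = L₃ at *
  -- The right-hand sides are filled in by unification in `hq`.
  obtain ⟨n₁, hn₁⟩ : ∃ n₁, n₁ = _ := ⟨_, rfl⟩
  obtain ⟨n₂, hn₂⟩ : ∃ n₂, n₂ = _ := ⟨_, rfl⟩
  obtain ⟨n₃, hn₃⟩ : ∃ n₃, n₃ = _ := ⟨_, rfl⟩
  have hq := sum_angle_deriv_eq p0.ne' p1.ne' p2.ne' hL0 hL1 hL2 hn₁ hn₂ hn₃
    (v₁ := v 0) (v₂ := v 1) (v₃ := v 2) rfl rfl rfl
  have hmix := mixed_sum_eq hL0 hL1 hL2 hn₁ hn₂ hn₃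
  have hfour := four_mul_sum_eq hL0 hL1 hL2 hn₁ hn₂ hn₃
  have hn : 0 < n₁ + n₂ + n₃ := by linarith
  obtain ⟨hform, hform0⟩ := form_nonneg (m₁ := n₁ / L₁) (m₂ := n₂ / L₂) (m₃ := n₃ / L₃) p0 p1 g₀
    (by rwa [div_mul_cancel₀ _ p0.ne', div_mul_cancel₀ _ p1.ne', div_mul_cancel₀ _ p2.ne'])
    (by
      have h1 : n₁ / L₁ * (n₂ / L₂) + n₂ / L₂ * (n₃ / L₃) + n₁ / L₁ * (n₃ / L₃)
          = (n₁ * n₂ * L₃ + n₂ * n₃ * L₁ + n₁ * n₃ * L₂) / (L₁ * L₂ * L₃) := by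
        field_simp
      rw [h1, hmix]
      positivity) (v 0) (v 1) (v 2)
  set q := n₁ / L₁ * (v 1 - v 2) ^ 2 + n₂ / L₂ * (v 0 - v 2) ^ 2 + n₃ / L₃ * (v 0 - v 1) ^ 2
  refine ⟨-(2 * q) / S, hsum.congr_deriv ?_, ?_, fun h0 => ?_⟩
  · rw [← hq]
    ring
  · exact div_nonpos_of_nonpos_of_nonneg (by linarith) hS0.le
  · have : q = 0 := by
      rcases div_eq_zero_iff.1 h0 with h0 | h0
      · linarith
      · exact absurd h0 hS0.ne'
    obtain ⟨h1, h2⟩ := hform0 this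
    intro a b
    fin_cases a <;> fin_cases b <;> simp [h1, h2]

omit h in
theorem finite_pi_pair (c d : ℝ) : {t : Fin 3 → ℝ | ∀ a, t a = c ∨ t a = d}.Finite := by
  have : {t : Fin 3 → ℝ | ∀ a, t a = c ∨ t a = d} = Set.pi univ fun _ => {c, d} := by
    ext t
    simp
  rw [this]
  exact Set.Finite.pi fun _ => Set.toFinite _

/-- The angles depend monotonically on the conformal factor. -/
theorem sum_cornerAngle_sub_mul_sub_nonpos (x y : Fin 3 → ℝ) :
    ∑ a, (cornerAngle e n x a - cornerAngle e n y a) * (x a - y a) ≤ 0 := by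
  have hanti : Antitone fun s : ℝ => ∑ a, (x - y) a * cornerAngle e n (y + s • (x - y)) a := by
    refine antitone_of_finite_image_compl ?_ {s : ℝ | Nondegenerate e n (y + s • (x - y))} ?_ ?_
    · refine continuous_finsetSum _ fun a _ => continuous_const.mul
        ((continuous_cornerAngle h a).comp ?_)
      fun_prop
    · intro s hs
      obtain ⟨q, hq, hle, -⟩ := exists_hasDerivAt_sum_cornerAngle h y (x - y) hs
      exact ⟨q, hq, hle⟩
    -- In a degenerate triangle every angle is π or 0, so the combination takes at most eight
    -- values.
    · refine ((finite_pi_pair Real.pi 0).image fun t => ∑ a, (x - y) a * t a).subset ?_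
      rintro _ ⟨s, hs, rfl⟩
      refine ⟨fun a => cornerAngle e n (y + s • (x - y)) a, fun a => ?_, rfl⟩
      dsimp only
      rw [cornerAngle_of_degenerate h hs]
      split_ifs <;> simp
  have h1 := hanti zero_le_one
  simp only [zero_smul, add_zero, one_smul, add_sub_cancel] at h1
  rw [← sub_nonpos, ← Finset.sum_sub_distrib] at h1
  refine (Finset.sum_congr rfl fun a _ => ?_).trans_le h1
  rw [Pi.sub_apply]
  ring

end Triangle

/-! ### The vector field of the flow on the surface -/

namespace CombinatorialRicci.Triangulation

open DissipativeFlow Triangle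
open scoped RealInnerProductSpace

variable {F : Type*} (T : Triangulation F) (ε : T.Vertex → ℝ) (η : T.Edge → ℝ)

/-- The angle at a corner of a face by the law of cosines, which includes the extension by
constants. -/
def clampedAngle (u : T.Vertex → ℝ) (f : F) (a : Fin 3) : ℝ :=
  cornerAngle (fun b => ε (T.vertex f b)) (fun b => η (T.oppEdge f b))
    (fun b => u (T.vertex f b)) a

theorem nondegenerateFace_iff (u : T.Vertex → ℝ) (f : F) :
    T.NondegenerateFace ε η u f ↔ Nondegenerate (fun b => ε (T.vertex f b))
      (fun b => η (T.oppEdge f b)) (fun b => u (T.vertex f b)) := Iff.rfl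

variable {T ε η}

theorem StructureConditions.isStructured (h : T.StructureConditions ε η) (f : F) :
    IsStructured (fun b => ε (T.vertex f b)) (fun b => η (T.oppEdge f b)) where
  zero_or_one _ := h.zero_or_one _
  edge_pos a := h.edge_pos (oppSide f a)
  face_nonneg a := h.face_nonneg f a

/-- In a degenerate triangle the cosine quotient leaves (-1, 1), where `Real.arccos` takes exactly
the prescribed constants. A single formula thus covers all cases and shows continuity. -/
theorem extAngle_eq_clampedAngle (h : T.StructureConditions ε η) (u : T.Vertex → ℝ) (f : F)
    (a : Fin 3) : T.extAngle ε η u f a = T.clampedAngle ε η u f a := by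
  rw [extAngle]
  split_ifs with h1 h2
  · rfl
  · exact ((cornerAngle_of_degenerate (h.isStructured f)
      ((T.nondegenerateFace_iff ε η u f).not.1 h1) a).trans (if_pos h2)).symm
  · exact ((cornerAngle_of_degenerate (h.isStructured f)
      ((T.nondegenerateFace_iff ε η u f).not.1 h1) a).trans (if_neg h2)).symm

/-- Glued sides share their initial vertex, so the common value on a face passes to the next face of
a chain. -/
theorem Connected.eq_of_eq_on_faces (hT : T.Connected) {v : T.Vertex → ℝ}
    (hv : ∀ f a b, v (T.vertex f a) = v (T.vertex f b)) (p q : T.Vertex) : v p = v q := by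
  have hface : ∀ f f' : F, v (T.vertex f 0) = v (T.vertex f' 0) := by
    intro f f'
    induction hT.2 f f' with
    | refl => rfl
    | tail _ hstep ih =>
      obtain ⟨d, rfl, rfl⟩ := hstep
      have hd : T.vertex d.face d.tail = T.vertex (T.glue d).face (T.glue d).tail :=
        Quot.sound ⟨d, rfl, rfl⟩
      rw [ih, hv _ 0 d.tail, hd, hv _ _ 0]
  obtain ⟨⟨f, a⟩, rfl⟩ := Quot.exists_rep p
  obtain ⟨⟨g, b⟩, rfl⟩ := Quot.exists_rep q
  change v (T.vertex f a) = v (T.vertex g b)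
  rw [hv f a 0, hv g b 0, hface f g]

variable [Fintype F]

variable (T ε η) in
/-- The vector field of the extended flow on the Euclidean space of conformal factors. -/
def flowField (Kbar : T.Vertex → ℝ) (x : EuclideanSpace ℝ T.Vertex) :
    EuclideanSpace ℝ T.Vertex :=
  WithLp.toLp 2 fun v => Kbar v - T.extCurvature ε η x.ofLp v

theorem isFlowOn_iff {Kbar : T.Vertex → ℝ} {u : ℝ → T.Vertex → ℝ} {I : Set ℝ} :
    T.IsFlowOn ε η Kbar u I ↔ ∀ t ∈ I, HasDerivWithinAt (fun s => WithLp.toLp 2 (u s))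
      (T.flowField ε η Kbar (WithLp.toLp 2 (u t))) I t := by
  refine forall₂_congr fun t _ => ?_
  rw [hasDerivWithinAt_iff_hasFDerivWithinAt, hasFDerivWithinAt_euclidean]
  refine forall_congr' fun v => ?_
  rw [hasDerivWithinAt_iff_hasFDerivWithinAt]
  refine iff_of_eq ?_
  congr 1

open Classical in
theorem extCurvature_eq (h : T.StructureConditions ε η) (u : T.Vertex → ℝ) (v : T.Vertex) :
    T.extCurvature ε η u v = 2 * Real.pi
      - ∑ f : F, ∑ a : Fin 3, if T.vertex f a = v then T.clampedAngle ε η u f a else 0 := by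
  simp only [extCurvature, extAngle_eq_clampedAngle h]

/-- Exchanging sums over vertices and corners isolates the contribution of each face; the remaining
term does not involve x. -/
theorem inner_flowField (h : T.StructureConditions ε η) (Kbar : T.Vertex → ℝ)
    (x w : EuclideanSpace ℝ T.Vertex) :
    ⟪T.flowField ε η Kbar x, w⟫ = ∑ v, (Kbar v - 2 * Real.pi) * w v
      + ∑ f : F, ∑ a : Fin 3, w (T.vertex f a) * T.clampedAngle ε η x.ofLp f a := by
  classical
  have h1 : ⟪T.flowField ε η Kbar x, w⟫ = ∑ v, (Kbar v - 2 * Real.pi) * w v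
      + ∑ v, ∑ f : F, ∑ a : Fin 3,
        if T.vertex f a = v then w v * T.clampedAngle ε η x.ofLp f a else 0 := by
    rw [PiLp.inner_apply, ← Finset.sum_add_distrib]
    refine Finset.sum_congr rfl fun v _ => ?_
    simp only [flowField, extCurvature_eq h, RCLike.inner_apply, conj_trivial]
    simp only [← mul_ite_zero, ← Finset.mul_sum]
    ring
  rw [h1, Finset.sum_comm]
  congr 1
  refine Finset.sum_congr rfl fun f _ => ?_
  rw [Finset.sum_comm]
  refine Finset.sum_congr rfl fun a _ => ?_
  simp

theorem continuous_flowField (h : T.StructureConditions ε η) (Kbar : T.Vertex → ℝ) :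
    Continuous (T.flowField ε η Kbar) := by
  classical
  refine (PiLp.continuous_toLp 2 _).comp (continuous_pi fun v => ?_)
  simp only [extCurvature_eq h]
  refine continuous_const.sub (continuous_const.sub
    (continuous_finsetSum _ fun f _ => continuous_finsetSum _ fun a _ => ?_))
  split_ifs
  · exact (continuous_cornerAngle (h.isStructured f) a).comp (by fun_prop)
  · exact continuous_const

theorem exists_norm_flowField_le (Kbar : T.Vertex → ℝ) :
    ∃ M, ∀ x, ‖T.flowField ε η Kbar x‖ ≤ M := by
  classical
  refine ⟨√(∑ v, (|Kbar v| + (2 * Real.pi + ∑ _f : F, ∑ _a : Fin 3, Real.pi)) ^ 2), fun x => ?_⟩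
  rw [EuclideanSpace.norm_eq]
  refine Real.sqrt_le_sqrt (Finset.sum_le_sum fun v _ => pow_le_pow_left₀ (norm_nonneg _) ?_ 2)
  change |Kbar v - T.extCurvature ε η x.ofLp v| ≤ _
  refine (abs_sub _ _).trans (add_le_add_right ((abs_sub _ _).trans (add_le_add ?_ ?_)) _)
  · rw [abs_of_pos Real.two_pi_pos]
  · refine (Finset.abs_sum_le_sum_abs _ _).trans (Finset.sum_le_sum fun f _ =>
      (Finset.abs_sum_le_sum_abs _ _).trans (Finset.sum_le_sum fun a _ => ?_))
    have hpi := Real.pi_pos.le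
    split_ifs
    · unfold extAngle
      split_ifs
      · rw [angle, abs_of_nonneg (Real.arccos_nonneg _)]
        exact Real.arccos_le_pi _
      · rw [abs_of_nonneg hpi]
      · rwa [abs_zero]
    · rwa [abs_zero]

/-- The terms independent of the factors cancel, and each face contributes a nonpositive amount by
monotonicity of its angles. -/
theorem flowField_dissipative (h : T.StructureConditions ε η) (Kbar : T.Vertex → ℝ)
    (x y : EuclideanSpace ℝ T.Vertex) :
    ⟪T.flowField ε η Kbar x - T.flowField ε η Kbar y, x - y⟫ ≤ 0 := by
  rw [inner_sub_left, inner_flowField h, inner_flowField h, add_sub_add_left_eq_sub,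
    ← Finset.sum_sub_distrib]
  refine Finset.sum_nonpos fun f _ => ?_
  rw [← Finset.sum_sub_distrib]
  refine (Finset.sum_congr rfl fun a _ => ?_).trans_le
    (sum_cornerAngle_sub_mul_sub_nonpos (h.isStructured f) (fun b => x (T.vertex f b))
      (fun b => y (T.vertex f b)))
  rw [← mul_sub, mul_comm]
  rfl

/-- The sum of the components of the vector field is constant. -/
theorem inner_flowField_one (h : T.StructureConditions ε η) (Kbar : T.Vertex → ℝ)
    (x : EuclideanSpace ℝ T.Vertex) :
    ⟪T.flowField ε η Kbar x, WithLp.toLp 2 1⟫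
      = ∑ v, (Kbar v - 2 * Real.pi) + ∑ _f : F, Real.pi := by
  rw [inner_flowField h]
  simp only [Pi.one_apply, mul_one, one_mul]
  congr 1
  -- Gauss–Bonnet: each face contributes π, degenerate or not.
  exact Finset.sum_congr rfl fun f _ => sum_cornerAngle (h.isStructured f) _

theorem differentiableAt_flowField (h : T.StructureConditions ε η) (Kbar : T.Vertex → ℝ)
    {x : EuclideanSpace ℝ T.Vertex} (hx : x.ofLp ∈ T.admissible ε η) :
    DifferentiableAt ℝ (T.flowField ε η Kbar) x := by
  classical
  rw [differentiableAt_euclidean]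
  intro v
  simp only [flowField, extCurvature_eq h]
  refine (differentiableAt_const _).sub ((differentiableAt_const _).sub
    (DifferentiableAt.fun_sum fun f _ => DifferentiableAt.fun_sum fun a _ => ?_))
  split_ifs
  · exact (differentiableAt_cornerAngle (h.isStructured f)
      ((T.nondegenerateFace_iff ε η _ f).1 (hx f)) a).comp
      (f := fun x : EuclideanSpace ℝ T.Vertex => fun b => x (T.vertex f b)) x (by fun_prop)
  · exact differentiableAt_const _

/-- At a nondegenerate factor the derivative of the vector field is negative definite on the
vectors with vanishing sum. -/
theorem inner_fderiv_flowField_neg (hT : T.Connected) (h : T.StructureConditions ε η)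
    (Kbar : T.Vertex → ℝ) {x : EuclideanSpace ℝ T.Vertex} (hx : x.ofLp ∈ T.admissible ε η)
    {w : EuclideanSpace ℝ T.Vertex} (hw : ∑ v, w v = 0) (hw0 : w ≠ 0) :
    ⟪fderiv ℝ (T.flowField ε η Kbar) x w, w⟫ < 0 := by
  have hline : HasDerivAt (fun s : ℝ => x + s • w) w 0 := by
    simpa using ((hasDerivAt_id (0 : ℝ)).smul_const w).const_add x
  have hd : HasDerivAt (fun s : ℝ => ⟪T.flowField ε η Kbar (x + s • w), w⟫)
      ⟪fderiv ℝ (T.flowField ε η Kbar) x w, w⟫ 0 := by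
    have h1 : HasFDerivAt (T.flowField ε η Kbar) (fderiv ℝ (T.flowField ε η Kbar) x)
        (x + (0 : ℝ) • w) := by
      simpa using (differentiableAt_flowField h Kbar hx).hasFDerivAt
    simpa using (h1.comp_hasDerivAt (0 : ℝ) hline).inner ℝ (hasDerivAt_const (0 : ℝ) w)
  have hface : ∀ f, ∃ q, HasDerivAt (fun s : ℝ => ∑ a : Fin 3,
      w (T.vertex f a) * T.clampedAngle ε η (x + s • w).ofLp f a) q 0 ∧ q ≤ 0 ∧
        (q = 0 → ∀ a b, w (T.vertex f a) = w (T.vertex f b)) := fun f =>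
    exists_hasDerivAt_sum_cornerAngle (h.isStructured f) (fun b => x (T.vertex f b))
      (fun b => w (T.vertex f b)) (by
        rw [zero_smul, add_zero]
        exact hx f)
  choose q hq hle hzero using hface
  have hd' := (HasDerivAt.fun_sum (u := Finset.univ) fun f _ => hq f).const_add
    (∑ v, (Kbar v - 2 * Real.pi) * w v)
  simp only [← inner_flowField h] at hd'
  rw [hd.unique hd']
  refine (Finset.sum_nonpos fun f _ => hle f).lt_of_ne fun hsum => hw0 ?_
  -- If the total vanishes, so does every face term; then w is constant on each face, hence
  -- globally, and sum zero makes it 0.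
  have hall := (Finset.sum_eq_zero_iff_of_nonpos fun f _ => hle f).1 hsum
  have hconst := hT.eq_of_eq_on_faces fun f => hzero f (hall f (Finset.mem_univ f))
  ext v
  have h1 : ∑ p, w p = Fintype.card T.Vertex * w v := by
    rw [Finset.sum_congr rfl fun p _ => hconst p v]
    simp
  rw [hw] at h1
  have h2 : (Fintype.card T.Vertex : ℝ) ≠ 0 :=
    Nat.cast_ne_zero.2 (Fintype.card_pos_iff.2 ⟨v⟩).ne'
  exact (mul_eq_zero.1 h1.symm).resolve_left h2

theorem flowField_eq_zero {ubar Kbar : T.Vertex → ℝ} (hu : ubar ∈ T.admissible ε η)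
    (hK : T.curvature ε η ubar = Kbar) : T.flowField ε η Kbar (WithLp.toLp 2 ubar) = 0 := by
  classical
  ext v
  have h1 : T.extCurvature ε η ubar v = T.curvature ε η ubar v := by
    simp only [extCurvature, curvature, extAngle, if_pos (hu _)]
  change Kbar v - T.extCurvature ε η ubar v = 0
  rw [h1, hK, sub_self]

theorem exists_isFlowOn_Ici (h : T.StructureConditions ε η) (Kbar u₀ : T.Vertex → ℝ) :
    ∃ u : ℝ → T.Vertex → ℝ, T.IsFlowOn ε η Kbar u (Ici 0) ∧ u 0 = u₀ := by
  obtain ⟨M, hM⟩ := exists_norm_flowField_le (T := T) (ε := ε) (η := η) Kbar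
  obtain ⟨u, hu0, hu⟩ := exists_global_solution (continuous_flowField h Kbar) hM
    (flowField_dissipative h Kbar) (WithLp.toLp 2 u₀)
  exact ⟨fun t => (u t).ofLp, isFlowOn_iff.2 hu, congrArg _ hu0⟩

/-- The sum of the conformal factors is preserved if the prescribed curvature is attained. -/
theorem sum_eq_of_isFlowOn (h : T.StructureConditions ε η) {Kbar ubar : T.Vertex → ℝ}
    (hu : ubar ∈ T.admissible ε η) (hK : T.curvature ε η ubar = Kbar) {u : ℝ → T.Vertex → ℝ}
    (hflow : T.IsFlowOn ε η Kbar u (Ici 0)) {t : ℝ} (ht : 0 ≤ t) : ∑ v, u t v = ∑ v, u 0 v := by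
  have hd : ∀ s ∈ Ici (0 : ℝ), HasDerivWithinAt (fun s => ∑ v, u s v) 0 (Ici 0) s := by
    intro s hs
    refine (HasDerivWithinAt.fun_sum fun v _ => hflow s hs v).congr_deriv ?_
    -- The component sum of the field is the same everywhere, and it is 0 at `ubar`.
    have h1 := (inner_flowField_one h Kbar (WithLp.toLp 2 (u s))).trans
      (inner_flowField_one h Kbar (WithLp.toLp 2 ubar)).symm
    rw [flowField_eq_zero hu hK, inner_zero_left] at h1
    simpa [PiLp.inner_apply, flowField] using h1
  have h1 := Convex.norm_image_sub_le_of_norm_hasDerivWithin_le (C := 0) hd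
    (fun _ _ => norm_zero.le) (convex_Ici 0) self_mem_Ici (mem_Ici.2 ht)
  rw [zero_mul] at h1
  exact sub_eq_zero.1 (norm_le_zero_iff.1 h1)

end CombinatorialRicci.Triangulation

end

/-! ### Conclusion -/

theorem theorem2p12 {F : Type*} [Fintype F] (T : CombinatorialRicci.Triangulation F) (hT : T.Connected)
    (ε : T.Vertex → ℝ) (η : T.Edge → ℝ) (hεη : T.StructureConditions ε η)
    (Kbar : T.Vertex → ℝ) :
    -- longtime existence, for every initial value
    (∀ u₀ : T.Vertex → ℝ, ∃ u : ℝ → T.Vertex → ℝ, T.IsFlowOn ε η Kbar u (Ici 0) ∧ u 0 = u₀) ∧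
    -- every solution up to a finite time extends to all times
    (∀ (t₁ : ℝ) (w : ℝ → T.Vertex → ℝ), 0 < t₁ → T.IsFlowOn ε η Kbar w (Ico 0 t₁) →
      ∃ u : ℝ → T.Vertex → ℝ, T.IsFlowOn ε η Kbar u (Ici 0) ∧ EqOn u w (Ico 0 t₁)) ∧
    -- exponential convergence
    (∀ ubar ∈ T.admissible ε η, T.curvature ε η ubar = Kbar →
      ∀ u : ℝ → T.Vertex → ℝ, T.IsFlowOn ε η Kbar u (Ici 0) → ∑ v, u 0 v = ∑ v, ubar v →
        ∃ C > 0, ∃ lam > 0, ∀ t ≥ 0, ‖u t - ubar‖ ≤ C * Real.exp (-(lam * t))) := by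
  open CombinatorialRicci.Triangulation DissipativeFlow in
  have hdiss := flowField_dissipative hεη Kbar
  refine ⟨exists_isFlowOn_Ici hεη Kbar, fun t₁ w ht₁ hw => ?_, fun ubar hubar hK u hu hsum => ?_⟩
  · obtain ⟨u, hu, hu0⟩ := exists_isFlowOn_Ici hεη Kbar (w 0)
    refine ⟨u, hu, fun t ht => ?_⟩
    have h1 := eqOn_of_dissipative hdiss ht₁
      (fun t ht => (isFlowOn_iff.1 hu t ht.1).mono Ico_subset_Ici_self) (isFlowOn_iff.1 hw)
      (congrArg _ hu0) ht
    exact WithLp.toLp_injective 2 h1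
  · have hzero := flowField_eq_zero hubar hK
    obtain ⟨r, hr, c, hc, hloc⟩ := exists_local_bound hzero
      (differentiableAt_flowField hεη Kbar hubar).hasFDerivAt
      -- W is the hyperplane of vectors of sum zero, to which u t - ubar is confined by conservation
      -- of the sum.
      (W := (Submodule.span ℝ {WithLp.toLp 2 (1 : T.Vertex → ℝ)})ᗮ) fun w hw hw0 => by
        rw [Submodule.mem_orthogonal_singleton_iff_inner_right] at hw
        exact inner_fderiv_flowField_neg hT hεη Kbar hubar
          (by simpa [PiLp.inner_apply] using hw) hw0
    obtain ⟨C, hC, lam, hlam, hbound⟩ := exponential_decay_of_local hdiss hzero hr hc hloc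
      (isFlowOn_iff.1 hu) fun t ht => by
        rw [Submodule.mem_orthogonal_singleton_iff_inner_right]
        have h1 := sum_eq_of_isFlowOn hεη hubar hK hu ht
        simp [PiLp.inner_apply, h1, hsum]
    refine ⟨C, hC, lam, hlam, fun t ht => le_trans ?_ (hbound t ht)⟩
    -- The norm on `T.Vertex → ℝ` is the sup norm, which the Euclidean norm dominates.
    refine (pi_norm_le_iff_of_nonneg (norm_nonneg _)).2 fun v => ?_
    exact PiLp.norm_apply_le (WithLp.toLp 2 (u t) - WithLp.toLp 2 ubar) v
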